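/- A permutation $\tau\in S_n$ is \emph{$321$-avoiding} if there are no indices $i_1<i_2<i_3$ with $\tau(i_1)>\tau(i_2)>\tau(i_3)$; let $\mathrm{Av}_n(321)$ be the set of such permutations. A \emph{rooted ordered tree} is a set $\mathbf t$ of finite words over $\{1,2,\dots\}$ that contains the empty word, is closed under prefixes, and is such that $ui\in\mathbf t$ and $1\le j\le i$ imply $uj\in\mathbf t$; it is \emph{locally finite} if $d_{\mathbf t}(u)=\max(0,\sup\{i: ui\in\mathbf t\})<\infty$ for every $u\in\mathbf t$. Put $d_{\mathbf t}(u)=-1$ for $u\notin\mathbf t$. The set $\mathfrak T$ of locally finite rooted ordered trees carries the topology in which $\mathbf t_n\to\mathbf t$ iff $d_{\mathbf t_n}(u)\to d_{\mathbf t}(u)$ for every word $u$, and its Borel $\sigma$-algebra. Let $\#\mathbf t$ be the number of vertices of $\mathbf t$. With $\xi(n)=2^{-n-1}$, $n\ge 0$, a \emph{Geometric$(1/2)$-Galton--Watson tree} is a $\mathfrak T$-valued random variable $T$ with $\mathbb P(T=\mathbf t)=\prod_{u\in\mathbf t}\xi(d_{\mathbf t}(u))$ for all $\mathbf t\in\mathfrak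 T$; such a tree is almost surely finite. \textbf{Theorem.} Let $\mathcal T_1,\mathcal T_2,\dots$ be an i.i.d. sequence of Geometric$(1/2)$-Galton--Watson trees, and let $(\tilde X,N)$ be a pair of $\{1,2,\dots\}$-valued random variables, independent of $(\mathcal T_j)_{j\ge1}$, such that $\mathbb P(\tilde X=k)=k\,2^{-k-1}$ for $k\ge 1$ and, conditionally given $\tilde X=k$, $N$ is uniformly distributed on $\{1,\dots,k\}$. If, for each $n$, $\tau_n$ is a uniformly random element of $\mathrm{Av}_n(321)$, then, as $n\to\infty$, \[ \left( \sum_{i=1}^{\lfloor n/2\rfloor} \delta_i \mathbf 1_{\{\tau_n(i)=i\}},\ \sum_{i=\lfloor n/2\rfloor+1}^{n} \delta_{n+1-i} \mathbf 1_{\{\tau_n(i)=i\}} \right) \overset{d}{\longrightarrow} \left( \sum_{i=1}^{N-1} \delta_{\sum_{j=1}^{i} \#\mathcal T_j} \mathbf 1_{\{\#\mathcal T_i=1\}},\ \sum_{i=N+1}^{\tilde X} \delta_{\sum_{j=i}^{\tilde X} \#\mathcal T_j} \mathbf 1_{\{\#\mathcal T_i=1\}} \right), \] the convergence being convergence in distribution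 on $\mathcal M_F(\{1,2,3,\dots\})^2$, where $\mathcal M_F(\{1,2,3,\dots\})$ is the set of finite measures on $\{1,2,3,\dots\}$ with the topology of weak convergence. -/

import Mathlib

open MeasureTheory ProbabilityTheory Filter
open scoped ENNReal

noncomputable section

/-! ### Pattern-avoiding permutations -/

/-- `τ ∈ S_n` contains an instance of the pattern `σ ∈ S_k`: there are indices
`i₁ < ⋯ < i_k` with `τ (i_s) < τ (i_t) ↔ σ s < σ t` for all `s < t`. -/
def ContainsPattern {n k : ℕ} (τ : Equiv.Perm (Fin n)) (σ : Equiv.Perm (Fin k)) : Prop :=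
  ∃ i : Fin k → Fin n, StrictMono i ∧ ∀ s t : Fin k, s < t → (τ (i s) < τ (i t) ↔ σ s < σ t)

/-- The pattern `321`, i.e. the order-reversing permutation of three letters. -/
def pattern321 : Equiv.Perm (Fin 3) := Fin.revPerm

/-- The set of `321`-avoiding permutations in `S_n`. -/
def Av321 (n : ℕ) : Set (Equiv.Perm (Fin n)) := {τ | ¬ ContainsPattern τ pattern321}

instance instMeasurableSpacePermFin (n : ℕ) : MeasurableSpace (Equiv.Perm (Fin n)) := ⊤

/-! ### Rooted ordered trees as subtrees of the Ulam–Harris tree -/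

/-- A locally finite rooted ordered tree: a set of finite words over `{1, 2, …}` containing the
empty word, closed under prefixes (ancestors) and under elder siblings, in which every vertex has
finitely many children. -/
@[ext]
structure OrderedTree where
  verts : Set (List ℕ+)
  root_mem : [] ∈ verts
  ancestor_mem : ∀ v w : List ℕ+, v ++ w ∈ verts → v ∈ verts
  sibling_mem : ∀ (u : List ℕ+) (i j : ℕ+), u ++ [i] ∈ verts → j ≤ i → u ++ [j] ∈ verts
  locallyFinite : ∀ u : List ℕ+, {i : ℕ+ | u ++ [i] ∈ verts}.Finite

namespace OrderedTree

/-- `0 ∨ sup {i : ui ∈ t}`, the number of children of `u` in `t`. -/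
def numChildren (t : OrderedTree) (u : List ℕ+) : ℕ :=
  sSup ((fun i : ℕ+ => (i : ℕ)) '' {i : ℕ+ | u ++ [i] ∈ t.verts})

open Classical in
/-- `d_t(u)`: the number of children of `u` if `u ∈ t`, and `-1` otherwise. -/
def deg (t : OrderedTree) (u : List ℕ+) : ℤ :=
  if u ∈ t.verts then (t.numChildren u : ℤ) else -1

/-- The number of vertices `#t`. -/
def size (t : OrderedTree) : ℕ∞ := t.verts.encard

/-- The local topology: `t_n → t` iff `d_{t_n}(u) → d_t(u)` for every word `u`. -/
instance : TopologicalSpace OrderedTree :=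
  TopologicalSpace.induced (fun t u => t.deg u) inferInstance

instance : MeasurableSpace OrderedTree := borel OrderedTree

instance : BorelSpace OrderedTree := ⟨rfl⟩

end OrderedTree

/-! ### Galton–Watson trees -/

/-- `T` is a Galton–Watson tree with offspring distribution `ξ` (a law of mean `1`):
`P(T = t) = ∏_{u ∈ t} ξ(d_t(u))` for every locally finite tree `t`. -/
def IsGaltonWatsonTree {Ω : Type*} [MeasurableSpace Ω] (ξ : PMF ℕ) (T : Ω → OrderedTree)
    (μ : Measure Ω) : Prop :=
  Measurable T ∧ ∀ t : OrderedTree, μ (T ⁻¹' {t}) = ∏' u : t.verts, ξ (t.numChildren u)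

/-- The Geometric(1/2) distribution `ξ(n) = 2^{-n-1}` on `{0, 1, 2, …}`. -/
def geomHalf : PMF ℕ :=
  ⟨fun n => (2⁻¹ : ℝ≥0∞) ^ (n + 1), by
    have h : ∑' n : ℕ, (2⁻¹ : ℝ≥0∞) ^ (n + 1) = 1 := by
      rw [ENNReal.tsum_geometric_add_one, ENNReal.one_sub_inv_two, inv_inv]
      exact ENNReal.inv_mul_cancel two_ne_zero ENNReal.ofNat_ne_top
    exact h ▸ ENNReal.summable.hasSum⟩

/-- The size-biased weights `n ξ(n)`, a probability distribution when `ξ` has mean `1`. -/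
def sizeBiased (ξ : PMF ℕ) (n : ℕ) : ℝ≥0∞ := n * ξ n

/-! ### Finite measures on `{1, 2, 3, …}` -/

instance instMeasurableSpacePNat : MeasurableSpace ℕ+ := ⊤

instance instBorelSpacePNat : BorelSpace ℕ+ :=
  ⟨(borel_eq_top_of_discrete (α := ℕ+)).symm⟩

/-- The Dirac mass at `x`. -/
def diracFM (x : ℕ+) : FiniteMeasure ℕ+ := ⟨Measure.dirac x, inferInstance⟩

/-- `M_F({1, 2, 3, …})²`, with the product of the weak topologies and its Borel `σ`-algebra. -/
def FiniteMeasurePair : Type := FiniteMeasure ℕ+ × FiniteMeasure ℕ+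

instance : TopologicalSpace FiniteMeasurePair :=
  inferInstanceAs (TopologicalSpace (FiniteMeasure ℕ+ × FiniteMeasure ℕ+))

instance : MeasurableSpace FiniteMeasurePair := borel FiniteMeasurePair

instance : BorelSpace FiniteMeasurePair := ⟨rfl⟩

/-- `∑_{i=1}^{⌊n/2⌋} δ_i 1{τ(i) = i}`. The index `a : Fin n` stands for `i = a + 1`. -/
def fixedPointsLeft {n : ℕ} (τ : Equiv.Perm (Fin n)) : FiniteMeasure ℕ+ :=
  ∑ a : Fin n, if (a : ℕ) + 1 ≤ n / 2 ∧ τ a = a then diracFM (Nat.succPNat a) else 0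

/-- `∑_{i=⌊n/2⌋+1}^{n} δ_{n+1-i} 1{τ(i) = i}`. The index `a : Fin n` stands for `i = a + 1`, so
that `n + 1 - i = (n - 1 - a) + 1`, where `n - 1 - a` is `Fin.rev a`. -/
def fixedPointsRight {n : ℕ} (τ : Equiv.Perm (Fin n)) : FiniteMeasure ℕ+ :=
  ∑ a : Fin n, if n / 2 + 1 ≤ (a : ℕ) + 1 ∧ τ a = a then diracFM (Nat.succPNat a.rev) else 0

/-- The pair of fixed-point measures of a permutation. -/
def fixedPointPair {n : ℕ} (τ : Equiv.Perm (Fin n)) : FiniteMeasurePair :=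
  (fixedPointsLeft τ, fixedPointsRight τ)

/-- `∑_{j=a}^{b} #t_j` as an element of `{1, 2, 3, …}`; the value is irrelevant (it is `1`) if some
tree is infinite, an event of probability zero for Galton–Watson trees of mean offspring `1`. -/
def cumulativeSize (t : ℕ+ → OrderedTree) (a b : ℕ+) : ℕ+ :=
  (∑ j ∈ Finset.Icc a b, (t j).size).toNat.toPNat'

open Classical in
/-- `∑_{i=1}^{N-1} δ_{∑_{j=1}^{i} #t_j} 1{#t_i = 1}`. -/
def spineLeft (t : ℕ+ → OrderedTree) (N : ℕ+) : FiniteMeasure ℕ+ :=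
  ∑ i ∈ Finset.Ico 1 N, if (t i).size = 1 then diracFM (cumulativeSize t 1 i) else 0

open Classical in
/-- `∑_{i=N+1}^{X} δ_{∑_{j=i}^{X} #t_j} 1{#t_i = 1}`. -/
def spineRight (t : ℕ+ → OrderedTree) (X N : ℕ+) : FiniteMeasure ℕ+ :=
  ∑ i ∈ Finset.Ioc N X, if (t i).size = 1 then diracFM (cumulativeSize t i X) else 0

/-- The pair of measures to the left and to the right of the spine. -/
def spinePair (t : ℕ+ → OrderedTree) (X N : ℕ+) : FiniteMeasurePair :=
  (spineLeft t N, spineRight t X N)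

end

/-! Both sides are functions of a pair of finite sets of positions, one read from each end, and such
pairs form a countable discrete space. It therefore suffices to prove convergence of the probability
of each pair (`tendstoInDistribution_of_tendsto_singleton`) and then to map positions continuously
to point measures.

Permutation side: a fixed point of a 321-avoiding permutation cuts it into a direct sum. Hence the
number with exactly the prescribed fixed points near the two ends is the product of the Fine numbers
(321-avoiding derangements) of all the gaps, the long middle gap included
(`fixCount_posSet_revSet`). The total number is a Catalan number (`ncard_Av321`). Since F_m / C_m →
4/9 and C_m / C_{m+k} → 4^{-k}, the probability tends to (4/9) 4^{-k} times the product of the Fine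
numbers of the short gaps, where k is the total length prescribed at the two ends.

Tree side: a Geometric(1/2) tree has s vertices with probability 2 C_{s-1} 4^{-s}. The size-biased
law of the spine degree and the uniform choice of `N` make the numbers of trees left and right of
the spine independent geometric variables. So a given pair of size sequences has probability 1/4
times the product of the weights C_{s-1} 4^{-s} (`measure_leftList_rightList`). Summing over the
sequences whose parts of size one have prescribed positions gives, on each side, (4/3) 4^{-length}
times the product of the Fine numbers of the gaps (`hillWeight_posSet`), because the first-part
recursion is the convolution recursion of the Fine numbers. Finally (1/4)(4/3)² = 4/9. -/

theorem mem_Av321_iff {n : ℕ} (τ : Equiv.Perm (Fin n)) :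
    τ ∈ Av321 n ↔ ∀ i j k : Fin n, i < j → j < k → τ j < τ i → τ k < τ j → False := by
  constructor
  · intro h i j k hij hjk h1 h2
    refine h ⟨![i, j, k], ?_, ?_⟩
    · intro s t hst
      fin_cases s <;> fin_cases t <;> simp at hst ⊢ <;> first | assumption | exact hij.trans hjk
    · intro s t hst
      have h3 := h2.trans h1
      fin_cases s <;> fin_cases t <;> simp [pattern321] at hst ⊢ <;> first | exact h1.le | exact h2.le | exact h3.le
  · rintro h ⟨f, hf, hp⟩
    have key : ∀ s t : Fin 3, s < t → τ (f t) < τ (f s) := by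
      intro s t hst
      have h1 : ¬ τ (f s) < τ (f t) := by
        rw [hp s t hst]; simp [pattern321, hst.le]
      exact lt_of_le_of_ne (not_lt.1 h1) (fun h => (hf hst).ne' (τ.injective h))
    exact h (f 0) (f 1) (f 2) (hf (by decide)) (hf (by decide)) (key 0 1 (by decide))
      (key 1 2 (by decide))

/-! ### Catalan enumeration of 321-avoiding permutations -/

/-- All lower entries of inversions of `τ` are smaller than `v`. -/
def InvBelow {n : ℕ} (τ : Equiv.Perm (Fin n)) (v : ℕ) : Prop :=
  ∀ i j : Fin n, i < j → τ j < τ i → (τ j : ℕ) < v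

/-- The permutation of `Fin (n + 1)` that ends with `u` and whose other entries are in the
relative order prescribed by `τ`. -/
def appendValue {n : ℕ} (u : Fin (n + 1)) (τ : Equiv.Perm (Fin n)) : Equiv.Perm (Fin (n + 1)) :=
  (finSuccEquiv' (Fin.last n)).trans (τ.optionCongr.trans (finSuccEquiv' u).symm)

@[simp] theorem appendValue_last {n : ℕ} (u : Fin (n + 1)) (τ : Equiv.Perm (Fin n)) :
    appendValue u τ (Fin.last n) = u := by
  simp [appendValue]

@[simp] theorem appendValue_castSucc {n : ℕ} (u : Fin (n + 1)) (τ : Equiv.Perm (Fin n))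
    (i : Fin n) : appendValue u τ i.castSucc = u.succAbove (τ i) := by
  have h : finSuccEquiv' (Fin.last n) i.castSucc = some i := by
    rw [← Fin.succAbove_last, finSuccEquiv'_succAbove]
  simp [appendValue, h]

theorem appendValue_injective {n : ℕ} :
    Function.Injective (fun p : Fin (n + 1) × Equiv.Perm (Fin n) => appendValue p.1 p.2) := by
  rintro ⟨u, τ⟩ ⟨u', τ'⟩ h
  have h1 : u = u' := by simpa using congrArg (fun σ => σ (Fin.last n)) h
  subst h1
  refine Prod.ext rfl (Equiv.ext fun i => ?_)
  have h2 := congrArg (fun σ => σ i.castSucc) h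
  simpa using h2

theorem appendValue_surjective {n : ℕ} :
    Function.Surjective (fun p : Fin (n + 1) × Equiv.Perm (Fin n) => appendValue p.1 p.2) := by
  refine ((Fintype.bijective_iff_injective_and_card _).2 ⟨appendValue_injective, ?_⟩).2
  simp [Fintype.card_perm, Nat.factorial_succ]

/-- A pattern 321 that uses the appended entry must end there, so it arises exactly from an
inversion of `τ` whose lower entry is at least `u`. -/
theorem appendValue_mem_Av321_iff {n : ℕ} (u : Fin (n + 1)) (τ : Equiv.Perm (Fin n)) :
    appendValue u τ ∈ Av321 (n + 1) ↔ τ ∈ Av321 n ∧ InvBelow τ u := by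
  simp only [mem_Av321_iff, InvBelow]
  constructor
  · intro h
    refine ⟨fun i j k hij hjk h1 h2 => h i.castSucc j.castSucc k.castSucc hij hjk (by simpa)
      (by simpa), fun i j hij h1 => ?_⟩
    by_contra hlt
    refine h i.castSucc j.castSucc (Fin.last n) hij (Fin.castSucc_lt_last j) (by simpa) ?_
    simp only [appendValue_last, appendValue_castSucc]
    rw [Fin.lt_succAbove_iff_le_castSucc]
    simpa [Fin.le_def] using hlt
  · rintro ⟨h, hb⟩ i j k
    induction k using Fin.lastCases with
    | last =>
      induction j using Fin.lastCases with
      | last => intro _ h; exact absurd h (lt_irrefl _)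
      | cast j =>
        induction i using Fin.lastCases with
        | last => intro h; exact absurd h (Fin.castSucc_lt_last j).not_gt
        | cast i =>
          intro hij _ h1 h2
          simp only [appendValue_last, appendValue_castSucc] at h1 h2
          rw [Fin.lt_succAbove_iff_le_castSucc] at h2
          have := hb i j hij (by simpa using h1)
          simp [Fin.le_def] at h2
          omega
    | cast k =>
      induction j using Fin.lastCases with
      | last => intro _ h; exact absurd h (Fin.castSucc_lt_last k).not_gt
      | cast j =>
        induction i using Fin.lastCases with
        | last => intro h; exact absurd h (Fin.castSucc_lt_last j).not_gt
        | cast i =>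
          intro hij hjk h1 h2
          exact h i j k hij hjk (by simpa using h1) (by simpa using h2)

/-- By `h` the lower entries of old inversions lie below `u`, so the insertion does not shift them.
The new inversions all end at the last position, and there are some exactly when `u` is not the
maximal value. -/
theorem invBelow_appendValue_iff {n : ℕ} {u : Fin (n + 1)} {τ : Equiv.Perm (Fin n)}
    (h : InvBelow τ u) (v : ℕ) :
    InvBelow (appendValue u τ) v ↔ InvBelow τ v ∧ ((u : ℕ) < n → (u : ℕ) < v) := by
  have hval : ∀ i j : Fin n, i < j → τ j < τ i → ((u.succAbove (τ j) : Fin (n+1)) : ℕ) = τ j := by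
    intro i j hij h1
    have := h i j hij h1
    rw [Fin.succAbove_of_castSucc_lt _ _ (by simpa [Fin.lt_def] using this)]
    simp
  constructor
  · intro hv
    refine ⟨fun i j hij h1 => ?_, fun hu => ?_⟩
    · have := hv i.castSucc j.castSucc hij (by simpa)
      rwa [appendValue_castSucc, hval i j hij h1] at this
    · obtain ⟨i, hi⟩ := τ.surjective ⟨u, hu⟩
      have := hv i.castSucc (Fin.last n) (Fin.castSucc_lt_last i) (by
        rw [appendValue_last, appendValue_castSucc, Fin.lt_succAbove_iff_le_castSucc, hi]
        simp)
      simpa using this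
  · rintro ⟨hv, hu⟩ i j
    induction j using Fin.lastCases with
    | last =>
      intro hi h1
      rw [appendValue_last] at h1 ⊢
      apply hu
      have := (appendValue u τ i).isLt
      have h2 : (u : ℕ) < (appendValue u τ i : ℕ) := h1
      omega
    | cast j =>
      induction i using Fin.lastCases with
      | last => intro h; exact absurd h (Fin.castSucc_lt_last j).not_gt
      | cast i =>
        intro hij h1
        have h2 : τ j < τ i := by simpa using h1
        rw [appendValue_castSucc, hval i j hij h2]
        exact hv i j hij h2

/-- The number of `321`-avoiding permutations whose inversions end below `v`. -/
noncomputable def invBelowCount (n v : ℕ) : ℕ := {τ : Equiv.Perm (Fin n) | τ ∈ Av321 n ∧ InvBelow τ v}.ncard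

theorem InvBelow.mono {n : ℕ} {τ : Equiv.Perm (Fin n)} {v w : ℕ} (h : InvBelow τ v) (hvw : v ≤ w) :
    InvBelow τ w := fun i j hij h1 => (h i j hij h1).trans_le hvw

theorem invBelow_self {n : ℕ} (τ : Equiv.Perm (Fin n)) : InvBelow τ n := fun _ _ _ _ => Fin.isLt _

/-- Counting by the last entry. -/
theorem invBelowCount_succ_aux (n v : ℕ) :
    invBelowCount (n + 1) v = ∑ u : Fin (n + 1),
      {τ : Equiv.Perm (Fin n) | (τ ∈ Av321 n ∧ InvBelow τ u) ∧
        InvBelow τ v ∧ ((u : ℕ) < n → (u : ℕ) < v)}.ncard := by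
  classical
  let e := Equiv.ofBijective _ ⟨appendValue_injective (n := n), appendValue_surjective⟩
  simp only [invBelowCount, Set.ncard_eq_toFinset_card', Set.toFinset_ofPred, Finset.card_filter]
  rw [← e.sum_comp, Fintype.sum_prod_type]
  refine Finset.sum_congr rfl fun u _ => Finset.sum_congr rfl fun τ _ => ?_
  refine if_congr ?_ rfl rfl
  change appendValue u τ ∈ _ ∧ InvBelow (appendValue u τ) v ↔ _
  rw [appendValue_mem_Av321_iff]
  exact and_congr_right fun h => invBelow_appendValue_iff h.2 v

/-- The maximal last value imposes no condition and gives the first term. A smaller last value `u`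
must be below `v`, and then the bound by `u` already implies the bound by `v`. -/
theorem invBelowCount_succ {n v : ℕ} (hv : v ≤ n) :
    invBelowCount (n + 1) v = invBelowCount n v + ∑ u ∈ Finset.range v, invBelowCount n u := by
  rw [invBelowCount_succ_aux, Fin.sum_univ_castSucc, add_comm]
  congr 1
  · simp [invBelowCount, invBelow_self]
  · have h1 : ∀ u : Fin n, {τ : Equiv.Perm (Fin n) | (τ ∈ Av321 n ∧ InvBelow τ u.castSucc) ∧
        InvBelow τ v ∧ ((u.castSucc : ℕ) < n → (u.castSucc : ℕ) < v)}.ncard =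
          if (u : ℕ) < v then invBelowCount n u else 0 := by
      intro u
      split_ifs with h
      · congr 1
        ext τ
        simp only [Set.mem_ofPred_eq, Fin.val_castSucc]
        exact ⟨fun hh => hh.1, fun hh => ⟨hh, hh.2.mono h.le, fun _ => h⟩⟩
      · simp [h]
    simp only [h1]
    rw [Fin.sum_univ_eq_sum_range (fun u => if u < v then invBelowCount n u else 0),
      ← Finset.sum_filter]
    congr 1
    ext x; simp; omega

theorem invBelowCount_eq_of_le {n v : ℕ} (h : n ≤ v + 1) :
    invBelowCount n v = (Av321 n).ncard := by
  unfold invBelowCount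
  congr 1
  ext τ
  simp only [Set.mem_ofPred_eq, and_iff_left_iff_imp]
  intro _ i j hij h1
  have h1' : (τ j : ℕ) < τ i := h1
  have := (τ i).isLt
  omega

/-- The entries of Catalan's triangle as differences of binomial coefficients. -/
theorem invBelowCount_add_choose {n v : ℕ} (hv : v ≤ n) :
    invBelowCount n v + (if v = 0 then 0 else (n + v).choose (v - 1)) = (n + v).choose v := by
  induction n generalizing v with
  | zero =>
    obtain rfl : v = 0 := by omega
    simp only [invBelowCount, mem_Av321_iff, InvBelow]
    simp
  | succ n ihn =>
    induction v with
    | zero =>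
      have := @ihn 0 (by omega)
      rw [invBelowCount_succ (by omega)]
      simpa using this
    | succ v ihv =>
      have h1 := ihv (by omega)
      -- Subtracting the recursion at consecutive bounds leaves the Pascal-type recursion of
      -- Catalan's triangle.
      have hstep : ∀ w, w + 1 ≤ n → invBelowCount (n + 1) (w + 1) =
          invBelowCount (n + 1) w + invBelowCount n (w + 1) := by
        intro w hw
        rw [invBelowCount_succ hw, invBelowCount_succ (by omega), Finset.sum_range_succ]
        ring
      rcases Nat.lt_or_ge v n with hvn | hvn
      · have h2 := @ihn (v + 1) (by omega)
        rw [hstep v (by omega)]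
        simp only [Nat.add_eq_zero_iff, one_ne_zero, and_false, if_false, Nat.add_sub_cancel] at h2 ⊢
        have e1 : n + 1 + (v + 1) = (n + v + 1) + 1 := by ring
        have e2 : n + 1 + v = n + v + 1 := by ring
        have e3 : n + (v + 1) = n + v + 1 := by ring
        rw [e2] at h1
        rw [e3] at h2
        rw [e1, Nat.choose_succ_succ' (n + v + 1) v]
        rcases v with _ | v
        · simp at h1 h2 ⊢; omega
        · simp only [Nat.add_eq_zero_iff, one_ne_zero, and_false, if_false, Nat.add_sub_cancel] at h1
          rw [Nat.choose_succ_succ' (n + (v + 1) + 1) v]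
          omega
      · obtain rfl : v = n := by omega
        -- On the diagonal `hstep` is not available; the last two entries of the row agree because
        -- the lower entry of an inversion is never the maximal value.
        have : invBelowCount (v + 1) (v + 1) = invBelowCount (v + 1) v := by
          rw [invBelowCount_eq_of_le (by omega), invBelowCount_eq_of_le (by omega)]
        rw [this]
        simp only [Nat.add_eq_zero_iff, one_ne_zero, and_false, if_false, Nat.add_sub_cancel]
        have e1 : v + 1 + (v + 1) = (2 * v + 1) + 1 := by ring
        have e2 : v + 1 + v = 2 * v + 1 := by ring
        rw [e2] at h1
        have hs : (2 * v + 1).choose (v + 1) = (2 * v + 1).choose v := by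
          rw [← Nat.choose_symm_of_eq_add (by omega : 2 * v + 1 = (v + 1) + v)]
        rw [e1, Nat.choose_succ_succ' (2 * v + 1) v, hs]
        rcases v with _ | v
        · simp at h1 ⊢; omega
        · simp only [Nat.add_eq_zero_iff, one_ne_zero, and_false, if_false, Nat.add_sub_cancel] at h1
          rw [Nat.choose_succ_succ' (2 * (v + 1) + 1) v]
          omega

/-- The number of `321`-avoiding permutations is a Catalan number. -/
theorem ncard_Av321 (n : ℕ) : (Av321 n).ncard = catalan n := by
  have h := invBelowCount_add_choose (le_refl n)
  rw [invBelowCount_eq_of_le (by omega)] at h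
  have h2 := succ_mul_catalan_eq_centralBinom n
  rw [Nat.centralBinom, two_mul] at h2
  have h3 : (n + 1) * (if n = 0 then 0 else (n + n).choose (n - 1)) = n * (n + n).choose n := by
    rcases n with _ | n
    · simp
    · have := Nat.choose_succ_right_eq (n + 1 + (n + 1)) n
      simp only [Nat.add_eq_zero_iff, one_ne_zero, and_false, if_false, Nat.add_sub_cancel]
      rw [show n + 1 + (n + 1) - n = n + 2 by omega] at this
      rw [mul_comm (n + 1) (Nat.choose _ (n + 1)), this]
      ring
  have h4 : (n + 1) * (Av321 n).ncard = (n + 1) * catalan n := by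
    rw [h2]
    have := congrArg ((n + 1) * ·) h
    simp only [mul_add, h3] at this
    nlinarith
  exact Nat.eq_of_mul_eq_mul_left (by omega) h4

/-! ### Direct sums and fixed points -/

/-- The permutation of `Fin (a + b)` that acts as `α` on the first `a` indices and as `β` on the
last `b` indices. -/
def directSum {a b : ℕ} (α : Equiv.Perm (Fin a)) (β : Equiv.Perm (Fin b)) :
    Equiv.Perm (Fin (a + b)) :=
  finSumFinEquiv.permCongr (Equiv.Perm.sumCongr α β)

@[simp] theorem directSum_castAdd {a b : ℕ} (α : Equiv.Perm (Fin a)) (β : Equiv.Perm (Fin b))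
    (i : Fin a) : directSum α β (Fin.castAdd b i) = Fin.castAdd b (α i) := by
  simp [directSum, Equiv.permCongr_apply]

@[simp] theorem directSum_natAdd {a b : ℕ} (α : Equiv.Perm (Fin a)) (β : Equiv.Perm (Fin b))
    (i : Fin b) : directSum α β (Fin.natAdd a i) = Fin.natAdd a (β i) := by
  simp [directSum, Equiv.permCongr_apply]

theorem directSum_injective (a b : ℕ) : Function.Injective
    (fun p : Equiv.Perm (Fin a) × Equiv.Perm (Fin b) => directSum p.1 p.2) := by
  rintro ⟨α, β⟩ ⟨α', β'⟩ h
  refine Prod.ext (Equiv.ext fun i => ?_) (Equiv.ext fun i => ?_)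
  · simpa using congrArg (fun σ => σ (Fin.castAdd b i)) h
  · simpa using congrArg (fun σ => σ (Fin.natAdd a i)) h

theorem exists_eq_directSum {a b : ℕ} (τ : Equiv.Perm (Fin (a + b)))
    (h : ∀ i : Fin (a + b), (i : ℕ) < a → (τ i : ℕ) < a) : ∃ α β, τ = directSum α β := by
  have hm : Set.MapsTo (finSumFinEquiv.symm.permCongr τ) (Set.range (Sum.inl : Fin a → _))
      (Set.range (Sum.inl : Fin a → Fin a ⊕ Fin b)) := by
    rintro _ ⟨i, rfl⟩
    have := h (Fin.castAdd b i) (by simp)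
    refine ⟨⟨_, this⟩, ?_⟩
    rw [Equiv.permCongr_apply, Equiv.symm_symm, finSumFinEquiv_apply_left, eq_comm,
      Equiv.symm_apply_eq]
    simp
  obtain ⟨⟨α, β⟩, hab⟩ := Equiv.Perm.mem_sumCongrHom_range_of_perm_mapsTo_inl hm
  refine ⟨α, β, ?_⟩
  have h2 : Equiv.Perm.sumCongr α β = finSumFinEquiv.symm.permCongr τ := hab
  rw [directSum, h2]
  ext; simp [Equiv.permCongr_apply]

theorem directSum_mem_Av321_iff {a b : ℕ} (α : Equiv.Perm (Fin a)) (β : Equiv.Perm (Fin b)) :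
    directSum α β ∈ Av321 (a + b) ↔ α ∈ Av321 a ∧ β ∈ Av321 b := by
  simp only [mem_Av321_iff]
  constructor
  · intro h
    refine ⟨fun i j k h1 h2 h3 h4 => h (Fin.castAdd b i) (Fin.castAdd b j) (Fin.castAdd b k)
      ?_ ?_ ?_ ?_, fun i j k h1 h2 h3 h4 => h (Fin.natAdd a i) (Fin.natAdd a j) (Fin.natAdd a k)
      ?_ ?_ ?_ ?_⟩ <;> simpa
  · rintro ⟨h1, h2⟩ i j k
    induction i using Fin.addCases <;> induction j using Fin.addCases <;>
      induction k using Fin.addCases <;>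
      simp only [directSum_castAdd, directSum_natAdd, Fin.lt_def, Fin.val_castAdd,
        Fin.val_natAdd, add_lt_add_iff_left] <;>
      first | exact h1 _ _ _ | exact h2 _ _ _ | omega

/-- The set of fixed points. -/
def fixedSet {n : ℕ} (τ : Equiv.Perm (Fin n)) : Finset ℕ :=
  (Finset.univ.filter fun i => τ i = i).map Fin.valEmbedding

theorem val_mem_fixedSet {n : ℕ} {τ : Equiv.Perm (Fin n)} {i : Fin n} :
    (i : ℕ) ∈ fixedSet τ ↔ τ i = i := by
  simp [fixedSet, ← Fin.ext_iff]

theorem lt_of_mem_fixedSet {n x : ℕ} {τ : Equiv.Perm (Fin n)} (h : x ∈ fixedSet τ) : x < n := by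
  simp only [fixedSet, Finset.mem_map] at h
  obtain ⟨i, _, rfl⟩ := h
  exact i.isLt

theorem fixedSet_subset {n : ℕ} (τ : Equiv.Perm (Fin n)) : fixedSet τ ⊆ Finset.range n :=
  fun _ hx => Finset.mem_range.2 (lt_of_mem_fixedSet hx)

theorem fixedSet_eq_iff {n : ℕ} (τ : Equiv.Perm (Fin n)) {F : Finset ℕ} (hF : F ⊆ Finset.range n) :
    fixedSet τ = F ↔ ∀ i : Fin n, τ i = i ↔ (i : ℕ) ∈ F := by
  constructor
  · rintro rfl i
    exact val_mem_fixedSet.symm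
  · intro h
    ext x
    constructor
    · intro hx
      exact (h ⟨x, lt_of_mem_fixedSet hx⟩).1 (val_mem_fixedSet.1 hx)
    · intro hx
      exact val_mem_fixedSet.2 ((h ⟨x, Finset.mem_range.1 (hF hx)⟩).2 hx)

theorem fixedSet_directSum {a b : ℕ} (α : Equiv.Perm (Fin a)) (β : Equiv.Perm (Fin b)) :
    fixedSet (directSum α β) = fixedSet α ∪ (fixedSet β).map (addLeftEmbedding a) := by
  rw [fixedSet_eq_iff]
  · intro i
    induction i using Fin.addCases with
    | left i =>
      have : ∀ x ∈ fixedSet β, a + x ≠ i := fun x _ => by omega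
      simp [Fin.val_castAdd, val_mem_fixedSet]
      exact fun x hx h => absurd h (this x hx)
    | right i =>
      have : a + (i : ℕ) ∉ fixedSet α := fun h => by have := lt_of_mem_fixedSet h; omega
      simp [this, val_mem_fixedSet]
  · intro x
    simp only [Finset.mem_union, Finset.mem_map, addLeftEmbedding_apply, Finset.mem_range]
    rintro (h | ⟨y, h, rfl⟩)
    · have := lt_of_mem_fixedSet h; omega
    · have := lt_of_mem_fixedSet h; omega

/-- A `321`-avoiding permutation preserves the indices below a fixed point. -/
theorem lt_of_lt_fixed {n : ℕ} {τ : Equiv.Perm (Fin n)} (hτ : τ ∈ Av321 n) {f : Fin n}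
    (hf : τ f = f) {i : Fin n} (hi : i < f) : τ i < f := by
  by_contra hlt
  have h1 : f < τ i := lt_of_le_of_ne (not_lt.1 hlt) fun h => hi.ne (τ.injective (by rw [hf, ← h]))
  -- If `i` jumps over `f`, then no `k > f` can fall below it, as `i, f, k` would form a 321. So `τ`
  -- permutes the indices above `f`, and the value `τ i` above `f` would have a second preimage
  -- there.
  have h2 : ∀ k, f < k → f < τ k := by
    intro k hk
    by_contra hk'
    have h3 : τ k < f := lt_of_le_of_ne (not_lt.1 hk') fun h =>
      hk.ne' (τ.injective (by rw [hf, h]))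
    exact (mem_Av321_iff τ).1 hτ i f k hi hk (by rwa [hf]) (by rwa [hf])
  have h3 : Set.BijOn τ (Set.Ioi f) (Set.Ioi f) := by
    refine ⟨h2, τ.injective.injOn, ?_⟩
    have h4 : τ '' Set.Ioi f ⊆ Set.Ioi f := Set.image_subset_iff.2 h2
    exact (Set.eq_of_subset_of_ncard_le h4
      (Set.ncard_image_of_injective _ τ.injective).ge (Set.toFinite _)).ge
  obtain ⟨k, hk, hki⟩ := h3.surjOn h1
  exact absurd (τ.injective hki ▸ hk : i ∈ Set.Ioi f) (not_lt.2 hi.le)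

/-- A fixed point allows a cut on either side of it: `k = f` just before, `k = f + 1` just after. -/
theorem preserves_of_mem_fixedSet {n : ℕ} {τ : Equiv.Perm (Fin n)} (hτ : τ ∈ Av321 n) {f k : ℕ}
    (hf : f ∈ fixedSet τ) (hk : k = f ∨ k = f + 1) (i : Fin n) (hi : (i : ℕ) < k) :
    (τ i : ℕ) < k := by
  have hfn := lt_of_mem_fixedSet hf
  have hfix : τ ⟨f, hfn⟩ = ⟨f, hfn⟩ := val_mem_fixedSet.1 hf
  rcases Nat.lt_or_ge i f with h | h
  · have := lt_of_lt_fixed hτ hfix (i := i) h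
    have : (τ i : ℕ) < f := this
    omega
  · obtain rfl : i = ⟨f, hfn⟩ := Fin.ext (by simp; omega)
    rw [hfix]
    exact hi

theorem union_map_addLeft_inj {k : ℕ} {A A' B B' : Finset ℕ} (hA : A ⊆ Finset.range k)
    (hA' : A' ⊆ Finset.range k) :
    A ∪ B.map (addLeftEmbedding k) = A' ∪ B'.map (addLeftEmbedding k) ↔ A = A' ∧ B = B' := by
  constructor
  · intro h
    simp only [Finset.ext_iff, Finset.mem_union, Finset.mem_map, addLeftEmbedding_apply] at h
    constructor
    · ext x
      by_cases hx : x < k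
      · have := h x
        have h0 : ∀ S : Finset ℕ, ¬ ∃ a ∈ S, k + a = x := fun S ⟨a, _, ha⟩ => by omega
        simpa [h0] using this
      · exact iff_of_false (fun h => hx (Finset.mem_range.1 (hA h)))
          (fun h => hx (Finset.mem_range.1 (hA' h)))
    · ext x
      have := h (k + x)
      have h1 : k + x ∉ A := fun h => by have := Finset.mem_range.1 (hA h); omega
      have h2 : k + x ∉ A' := fun h => by have := Finset.mem_range.1 (hA' h); omega
      simpa [h1, h2] using this
  · rintro ⟨rfl, rfl⟩; rfl

/-! ### Permutations with prescribed fixed points and Fine numbers -/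

/-- The number of `321`-avoiding permutations of `Fin n` with a given set of fixed points. -/
noncomputable def fixCount (n : ℕ) (F : Finset ℕ) : ℕ :=
  {τ : Equiv.Perm (Fin n) | τ ∈ Av321 n ∧ fixedSet τ = F}.ncard

/-- The number of `321`-avoiding derangements of `Fin n`. -/
noncomputable def fineNumber (n : ℕ) : ℕ := fixCount n ∅

/-- The product rule behind all the factorisations: `hp` forces a cut at `a`, and `hpqr` says that
the property splits over the two blocks. -/
theorem ncard_directSum {a b : ℕ} (p : Equiv.Perm (Fin (a + b)) → Prop)
    (q : Equiv.Perm (Fin a) → Prop) (r : Equiv.Perm (Fin b) → Prop)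
    (hp : ∀ τ ∈ Av321 (a + b), p τ → ∀ i : Fin (a + b), (i : ℕ) < a → (τ i : ℕ) < a)
    (hpqr : ∀ α β, p (directSum α β) ↔ q α ∧ r β) :
    {τ | τ ∈ Av321 (a + b) ∧ p τ}.ncard =
      {α | α ∈ Av321 a ∧ q α}.ncard * {β | β ∈ Av321 b ∧ r β}.ncard := by
  rw [← Set.ncard_prod, ← Set.ncard_image_of_injective _ (directSum_injective a b)]
  congr 1
  ext τ
  constructor
  · rintro ⟨h1, h2⟩
    obtain ⟨α, β, rfl⟩ := exists_eq_directSum τ (hp τ h1 h2)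
    rw [directSum_mem_Av321_iff] at h1
    rw [hpqr] at h2
    exact ⟨(α, β), ⟨⟨h1.1, h2.1⟩, ⟨h1.2, h2.2⟩⟩, rfl⟩
  · rintro ⟨⟨α, β⟩, ⟨⟨h1, h2⟩, ⟨h3, h4⟩⟩, rfl⟩
    exact ⟨(directSum_mem_Av321_iff _ _).2 ⟨h1, h3⟩, (hpqr _ _).2 ⟨h2, h4⟩⟩

theorem fixCount_union {a b : ℕ} {A B : Finset ℕ} (hA : A ⊆ Finset.range a)
    (h : ∃ f ∈ A ∪ B.map (addLeftEmbedding a), a = f ∨ a = f + 1) :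
    fixCount (a + b) (A ∪ B.map (addLeftEmbedding a)) = fixCount a A * fixCount b B := by
  refine ncard_directSum _ _ _ ?_ ?_
  · obtain ⟨f, hf, hfa⟩ := h
    intro τ hτ hτF
    exact preserves_of_mem_fixedSet hτ (hτF ▸ hf) hfa
  · intro α β
    rw [fixedSet_directSum, union_map_addLeft_inj (fixedSet_subset α) hA]

theorem fixCount_succ_singleton (g : ℕ) : fixCount (g + 1) {g} = fineNumber g := by
  have h := fixCount_union (a := g) (b := 1) (A := ∅) (B := {0}) (by simp) ⟨g, by simp, by simp⟩
  have h1 : fixCount 1 {0} = 1 := by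
    have : {τ : Equiv.Perm (Fin 1) | τ ∈ Av321 1 ∧ fixedSet τ = {0}} = Set.univ := by
      refine Set.eq_univ_of_forall fun τ => ⟨?_, ?_⟩
      · rw [mem_Av321_iff]
        intro i j k hij
        omega
      · rw [fixedSet_eq_iff _ (by simp)]
        intro i
        simp [Subsingleton.elim (τ i) i]
    rw [fixCount, this]
    simp
  simpa [h1, fineNumber] using h

/-- The set of positions with given successive gaps. -/
def posSet : List ℕ → Finset ℕ
  | [] => ∅
  | g :: G => {g} ∪ (posSet G).map (addLeftEmbedding (g + 1))

/-- One more than the largest position, or zero if there are no positions. -/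
def gapLength : List ℕ → ℕ
  | [] => 0
  | g :: G => g + 1 + gapLength G

theorem posSet_subset (G : List ℕ) : posSet G ⊆ Finset.range (gapLength G) := by
  induction G with
  | nil => simp [posSet]
  | cons g G ih =>
    intro x hx
    simp only [posSet, Finset.mem_union, Finset.mem_singleton, Finset.mem_map,
      addLeftEmbedding_apply] at hx
    simp only [gapLength, Finset.mem_range]
    rcases hx with rfl | ⟨y, hy, rfl⟩
    · omega
    · have := Finset.mem_range.1 (ih hy); omega

/-- Reading off successive gaps encodes every finite set, so point probabilities need to be computed
only for sets given by gap lists. The induction removes the minimum and shifts the rest to the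
origin. -/
theorem posSet_surjective : Function.Surjective posSet := by
  have key : ∀ m (F : Finset ℕ), F ⊆ Finset.range m → ∃ G, posSet G = F := by
    intro m
    induction m using Nat.strong_induction_on with
    | _ m ih =>
      intro F hF
      rcases F.eq_empty_or_nonempty with rfl | hne
      · exact ⟨[], rfl⟩
      · set g := F.min' hne with hg
        have hgF : g ∈ F := F.min'_mem hne
        have hgm := Finset.mem_range.1 (hF hgF)
        obtain ⟨G, hG⟩ := ih (m - (g + 1)) (by omega)
          ((Finset.range (m - (g + 1))).filter fun x => g + 1 + x ∈ F) (Finset.filter_subset _ _)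
        refine ⟨g :: G, ?_⟩
        ext x
        simp only [posSet, hG, Finset.mem_union, Finset.mem_singleton, Finset.mem_map,
          addLeftEmbedding_apply, Finset.mem_filter, Finset.mem_range]
        constructor
        · rintro (rfl | ⟨y, ⟨_, hy⟩, rfl⟩)
          · exact hgF
          · exact hy
        · intro hx
          have h1 : g ≤ x := F.min'_le x hx
          have h2 := Finset.mem_range.1 (hF hx)
          rcases h1.eq_or_lt with h | h
          · exact Or.inl h.symm
          · refine Or.inr ⟨x - (g + 1), ⟨by omega, ?_⟩, by omega⟩
            rwa [show g + 1 + (x - (g + 1)) = x by omega]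
  intro F
  obtain ⟨m, hm⟩ := F.exists_nat_subset_range
  exact key m F hm

/-- Each cut is made right after the first prescribed fixed point; the block cut off is a
derangement of the gap followed by one fixed point. -/
theorem fixCount_posSet_union (G : List ℕ) (m : ℕ) (F : Finset ℕ) :
    fixCount (gapLength G + m) (posSet G ∪ F.map (addLeftEmbedding (gapLength G))) =
      (G.map fineNumber).prod * fixCount m F := by
  induction G with
  | nil =>
    simp [gapLength, posSet]
    congr 1
    ext; simp
  | cons g G ih =>
    have h := fixCount_union (a := g + 1) (b := gapLength G + m) (A := {g})
      (B := posSet G ∪ F.map (addLeftEmbedding (gapLength G))) (by simp) ⟨g, by simp, by simp⟩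
    rw [ih, fixCount_succ_singleton] at h
    rw [List.map_cons, List.prod_cons, mul_assoc, ← h, gapLength, ← add_assoc, posSet,
      Finset.map_union, Finset.map_map, Finset.union_assoc]
    congr 3
    ext
    simp [add_assoc]

/-! ### Reflection, for fixed points counted from the right end -/

/-- The reflection of a set of positions in `{0, …, n - 1}`. -/
def revSet (n : ℕ) (F : Finset ℕ) : Finset ℕ := F.image fun x => n - 1 - x

theorem revSet_subset {n : ℕ} {F : Finset ℕ} (hF : F ⊆ Finset.range n) :
    revSet n F ⊆ Finset.range n := by
  intro x hx
  obtain ⟨y, hy, rfl⟩ := Finset.mem_image.1 hx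
  have := Finset.mem_range.1 (hF hy)
  simp; omega

theorem rev_mem_revSet {n : ℕ} {F : Finset ℕ} (hF : F ⊆ Finset.range n) (i : Fin n) :
    (i.rev : ℕ) ∈ revSet n F ↔ (i : ℕ) ∈ F := by
  simp only [revSet, Finset.mem_image, Fin.val_rev]
  constructor
  · rintro ⟨x, hx, h⟩
    have := Finset.mem_range.1 (hF hx)
    obtain rfl : x = i := by omega
    exact hx
  · exact fun h => ⟨i, h, by omega⟩

/-- Conjugation by the order-reversing permutation. -/
def revConj {n : ℕ} (τ : Equiv.Perm (Fin n)) : Equiv.Perm (Fin n) := Fin.revPerm.permCongr τ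

theorem revConj_apply {n : ℕ} (τ : Equiv.Perm (Fin n)) (i : Fin n) :
    revConj τ i = (τ i.rev).rev := by
  simp [revConj]

theorem revConj_revConj {n : ℕ} (τ : Equiv.Perm (Fin n)) : revConj (revConj τ) = τ := by
  ext i; simp [revConj_apply]

theorem revConj_mem_Av321 {n : ℕ} {τ : Equiv.Perm (Fin n)} (h : τ ∈ Av321 n) :
    revConj τ ∈ Av321 n := by
  rw [mem_Av321_iff] at h ⊢
  intro i j k hij hjk h1 h2
  rw [revConj_apply, revConj_apply, Fin.rev_lt_rev] at h1 h2
  exact h k.rev j.rev i.rev (Fin.rev_lt_rev.2 hjk) (Fin.rev_lt_rev.2 hij) h2 h1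

theorem fixedSet_revConj {n : ℕ} (τ : Equiv.Perm (Fin n)) :
    fixedSet (revConj τ) = revSet n (fixedSet τ) := by
  rw [fixedSet_eq_iff _ (revSet_subset (fixedSet_subset τ))]
  intro i
  have := rev_mem_revSet (fixedSet_subset τ) i.rev
  rw [Fin.rev_rev] at this
  rw [this, val_mem_fixedSet, revConj_apply, Fin.rev_eq_iff]

theorem revSet_revSet {n : ℕ} {F : Finset ℕ} (hF : F ⊆ Finset.range n) :
    revSet n (revSet n F) = F := by
  rw [revSet, revSet, Finset.image_image]
  conv_rhs => rw [← Finset.image_id (s := F)]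
  refine Finset.image_congr fun x hx => ?_
  have := Finset.mem_range.1 (hF hx)
  simp; omega

theorem fixCount_revSet {n : ℕ} {F : Finset ℕ} (hF : F ⊆ Finset.range n) :
    fixCount n (revSet n F) = fixCount n F := by
  have hinj : Function.Injective (revConj (n := n)) :=
    Function.LeftInverse.injective (g := revConj) revConj_revConj
  rw [fixCount, fixCount,
    ← Set.ncard_image_of_injective {τ | τ ∈ Av321 n ∧ fixedSet τ = F} hinj]
  congr 1
  ext τ
  constructor
  · rintro ⟨h1, h2⟩
    refine ⟨revConj τ, ⟨revConj_mem_Av321 h1, ?_⟩, revConj_revConj τ⟩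
    rw [fixedSet_revConj, h2, revSet_revSet hF]
  · rintro ⟨σ, ⟨h1, h2⟩, rfl⟩
    exact ⟨revConj_mem_Av321 h1, by rw [fixedSet_revConj, h2]⟩

/-- The number of `321`-avoiding permutations with prescribed fixed points near both ends and no
other fixed points. -/
theorem fixCount_posSet_revSet (G H : List ℕ) (m : ℕ) :
    fixCount (gapLength G + (gapLength H + m))
      (posSet G ∪ revSet (gapLength G + (gapLength H + m)) (posSet H)) =
      (G.map fineNumber).prod * (H.map fineNumber).prod * fineNumber m := by
  have hH : posSet H ⊆ Finset.range (gapLength H + m) :=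
    (posSet_subset H).trans (Finset.range_mono (by omega))
  have h1 : revSet (gapLength G + (gapLength H + m)) (posSet H) =
      (revSet (gapLength H + m) (posSet H)).map (addLeftEmbedding (gapLength G)) := by
    rw [Finset.map_eq_image, revSet, revSet, Finset.image_image]
    refine Finset.image_congr fun x hx => ?_
    have := Finset.mem_range.1 (hH hx)
    simp; omega
  have h2 := fixCount_posSet_union H m ∅
  rw [h1, fixCount_posSet_union, fixCount_revSet hH, mul_assoc]
  rw [Finset.map_empty, Finset.union_empty] at h2
  rw [h2, fineNumber]

/-- Decomposition of `321`-avoiding permutations at the first fixed point. -/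
theorem catalan_eq_fineNumber_add (n : ℕ) :
    catalan n = fineNumber n +
      ∑ f ∈ Finset.range n, fineNumber f * catalan (n - 1 - f) := by
  classical
  -- The first fixed point, with `n` as a sentinel value for derangements.
  let m : Equiv.Perm (Fin n) → ℕ := fun τ => (insert n (fixedSet τ)).min' (Finset.insert_nonempty _ _)
  have hm : ∀ τ : Equiv.Perm (Fin n), ∀ f < n, m τ = f ↔ fixedSet τ ∩ Finset.range (f + 1) = {f} := by
    intro τ f hf
    simp only [m, Finset.min'_eq_iff, Finset.mem_insert, Finset.ext_iff, Finset.mem_inter,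
      Finset.mem_range, Finset.mem_singleton]
    constructor
    · rintro ⟨h1 | h1, h2⟩ x
      · omega
      · constructor
        · rintro ⟨h3, h4⟩
          have := h2 x (Or.inr h3); omega
        · rintro rfl
          exact ⟨h1, by omega⟩
    · intro h
      refine ⟨Or.inr ((h f).2 rfl).1, ?_⟩
      rintro b (rfl | hb)
      · exact hf.le
      · by_contra hlt
        have := (h b).1 ⟨hb, by omega⟩
        omega
  have hmn : ∀ τ : Equiv.Perm (Fin n), m τ = n ↔ fixedSet τ = ∅ := by
    intro τ
    simp only [m, Finset.min'_eq_iff, Finset.mem_insert, true_or, true_and]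
    constructor
    · intro h
      refine Finset.eq_empty_of_forall_notMem fun x hx => ?_
      have := h x (Or.inr hx)
      have := lt_of_mem_fixedSet hx
      omega
    · intro h b hb
      simp [h] at hb
      exact hb.ge
  rw [← ncard_Av321, Set.ncard_eq_toFinset_card',
    Finset.card_eq_sum_card_fiberwise (f := m) (t := Finset.range (n + 1)),
    Finset.sum_range_succ, add_comm]
  · congr 1
    · rw [fineNumber, fixCount, Set.ncard_eq_toFinset_card']
      congr 1
      ext τ
      simp [hmn]
    · refine Finset.sum_congr rfl fun f hf => ?_
      obtain ⟨b, rfl⟩ : ∃ b, n = f + 1 + b := ⟨n - (f + 1), by have := Finset.mem_range.1 hf; omega⟩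
      -- Cutting right after the first fixed point: the left block has `f` as its only fixed point,
      -- the right block is arbitrary.
      have h := ncard_directSum (a := f + 1) (b := b)
        (fun τ => fixedSet τ ∩ Finset.range (f + 1) = {f}) (fun α => fixedSet α = {f})
        (fun _ => True) ?_ ?_
      · rw [show f + 1 + b - 1 - f = b by omega, ← ncard_Av321, ← fixCount_succ_singleton, fixCount]
        simp only [and_true] at h
        rw [show {β | β ∈ Av321 b} = Av321 b from rfl] at h
        rw [← h, Set.ncard_eq_toFinset_card']
        congr 1
        ext τ
        simp [hm τ f (by omega)]
      · intro τ hτ hf2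
        refine preserves_of_mem_fixedSet hτ (f := f) ?_ (Or.inr rfl)
        have : f ∈ fixedSet τ ∩ Finset.range (f + 1) := by rw [hf2]; simp
        exact (Finset.mem_inter.1 this).1
      · intro α β
        rw [fixedSet_directSum, and_true]
        suffices (fixedSet α ∪ (fixedSet β).map (addLeftEmbedding (f + 1))) ∩ Finset.range (f + 1) =
            fixedSet α by rw [this]
        ext x
        simp only [Finset.mem_inter, Finset.mem_union, Finset.mem_map, addLeftEmbedding_apply,
          Finset.mem_range]
        constructor
        · rintro ⟨h | ⟨y, _, rfl⟩, h2⟩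
          · exact h
          · omega
        · exact fun h => ⟨Or.inl h, lt_of_mem_fixedSet h⟩
  · intro τ _
    have : m τ ≤ n := Finset.min'_le _ _ (Finset.mem_insert_self _ _)
    simp; omega

/-! ### Generating functions and recursions for the Fine numbers -/

/-- The generating function of the Catalan numbers over the integers. -/
noncomputable def catalanGF : PowerSeries ℤ := PowerSeries.mk fun n => (catalan n : ℤ)

/-- The generating function of the Fine numbers. -/
noncomputable def fineGF : PowerSeries ℤ := PowerSeries.mk fun n => (fineNumber n : ℤ)

theorem catalanGF_eq : catalanGF = 1 + PowerSeries.X * catalanGF * catalanGF := by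
  ext n
  rcases n with _ | n
  · simp [catalanGF]
  · rw [map_add, mul_assoc, PowerSeries.coeff_succ_X_mul, PowerSeries.coeff_mul]
    simp [catalanGF, PowerSeries.coeff_one, catalan_succ']

theorem catalanGF_eq_fineGF : catalanGF = fineGF + PowerSeries.X * fineGF * catalanGF := by
  ext n
  rcases n with _ | n
  · have := catalan_eq_fineNumber_add 0
    simp at this
    simp [catalanGF, fineGF, ← this]
  · rw [map_add, mul_assoc, PowerSeries.coeff_succ_X_mul, PowerSeries.coeff_mul,
      Finset.Nat.sum_antidiagonal_eq_sum_range_succ_mk]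
    have := catalan_eq_fineNumber_add (n + 1)
    simp only [catalanGF, fineGF, PowerSeries.coeff_mk, this]
    simp

/-- Multiplying by 1 + XC and using F(1 + XC) = C and XC² = C - 1 turns both sides into (2 + X)C.
This linear relation drives the asymptotics of F_n / C_n. -/
theorem two_add_X_mul_fineGF : (2 + PowerSeries.X) * fineGF = catalanGF + 1 := by
  have h1 := catalanGF_eq
  have h2 := catalanGF_eq_fineGF
  have h0 : (1 + PowerSeries.X * catalanGF : PowerSeries ℤ) ≠ 0 := by
    intro h
    have := congrArg PowerSeries.constantCoeff h
    simp at this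
  apply mul_left_cancel₀ h0
  linear_combination (-(2 + PowerSeries.X)) * h2 + h1

theorem fineGF_mul : fineGF * (1 + PowerSeries.X - PowerSeries.X * catalanGF) = 1 := by
  have h1 := catalanGF_eq
  have h2 := catalanGF_eq_fineGF
  have h0 : catalanGF ≠ 0 := by
    intro h
    have := congrArg PowerSeries.constantCoeff h
    simp [catalanGF] at this
  apply mul_left_cancel₀ h0
  linear_combination fineGF * h1 - h2

theorem fineNumber_zero : fineNumber 0 = 1 := by
  have := catalan_eq_fineNumber_add 0
  simpa using this.symm

theorem catalan_succ_eq_fineNumber (n : ℕ) :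
    catalan (n + 1) = 2 * fineNumber (n + 1) + fineNumber n := by
  have h := congrArg (PowerSeries.coeff (n + 1)) two_add_X_mul_fineGF
  rw [add_mul, map_add, PowerSeries.coeff_succ_X_mul, map_add,
    show (2 : PowerSeries ℤ) = PowerSeries.C (2 : ℤ) by simp, PowerSeries.coeff_C_mul] at h
  simp [fineGF, catalanGF, PowerSeries.coeff_one] at h
  omega

/-- In the coefficients of F(1 + X - XC) = 1 the term with C_0 cancels F_g. What remains is a sum
over a first part of size `i + 2`, which is how it reappears in `hillWeight_posSet_cons`. -/
theorem fineNumber_succ (g : ℕ) : fineNumber (g + 1) =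
    ∑ i ∈ Finset.range g, catalan (i + 1) * fineNumber (g - 1 - i) := by
  have h := congrArg (PowerSeries.coeff (g + 1)) fineGF_mul
  rw [mul_sub, mul_add, mul_one, map_sub, map_add, mul_comm fineGF PowerSeries.X,
    PowerSeries.coeff_succ_X_mul, mul_comm fineGF, mul_assoc, PowerSeries.coeff_succ_X_mul,
    PowerSeries.coeff_mul, Finset.Nat.sum_antidiagonal_eq_sum_range_succ_mk,
    Finset.sum_range_succ'] at h
  simp only [fineGF, catalanGF, PowerSeries.coeff_mk, PowerSeries.coeff_one] at h
  simp only [Nat.add_eq_zero_iff, one_ne_zero, and_false, if_false, catalan_zero, Nat.cast_one,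
    one_mul, Nat.sub_zero] at h
  have h2 : (fineNumber (g + 1) : ℤ) =
      ∑ x ∈ Finset.range g, (catalan (x + 1) : ℤ) * fineNumber (g - (x + 1)) := by linarith
  have h3 : ∀ i, g - 1 - i = g - (i + 1) := fun i => by omega
  simp only [h3]
  exact_mod_cast h2

/-! ### Asymptotics of Catalan and Fine numbers -/

theorem catalan_pos (n : ℕ) : 0 < catalan n := by
  have h := succ_mul_catalan_eq_centralBinom n
  have := Nat.centralBinom_pos n
  exact Nat.pos_of_ne_zero fun h0 => by rw [h0] at h; omega

theorem catalan_div_succ (n : ℕ) :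
    (catalan n : ℝ) / catalan (n + 1) = (n + 2) / (4 * n + 2) := by
  have h0 : (0 : ℝ) < catalan (n + 1) := by exact_mod_cast catalan_pos _
  rw [div_eq_div_iff h0.ne' (by positivity)]
  have h1 : ((n : ℝ) + 1) * catalan n = n.centralBinom := by
    exact_mod_cast succ_mul_catalan_eq_centralBinom n
  have h2 : ((n : ℝ) + 1 + 1) * catalan (n + 1) = (n + 1).centralBinom := by
    exact_mod_cast succ_mul_catalan_eq_centralBinom (n + 1)
  have h3 : ((n : ℝ) + 1) * (n + 1).centralBinom = 2 * (2 * n + 1) * n.centralBinom := by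
    exact_mod_cast Nat.succ_mul_centralBinom_succ n
  have h4 : ((n : ℝ) + 1) ≠ 0 := by positivity
  apply mul_left_cancel₀ h4
  linear_combination (4 * n + 2) * h1 - (n + 1) * h2 - h3

theorem tendsto_catalan_div_succ :
    Tendsto (fun n : ℕ => (catalan n : ℝ) / catalan (n + 1)) atTop (nhds (1 / 4)) := by
  have h : ∀ n : ℕ, (catalan n : ℝ) / catalan (n + 1) =
      1 / 4 + (3 / 8) * (1 / ((n : ℝ) + 1 / 2)) := by
    intro n
    rw [catalan_div_succ]
    have : (n : ℝ) + 1 / 2 ≠ 0 := by positivity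
    field_simp
    ring
  simp only [h]
  have : Tendsto (fun n : ℕ => 1 / ((n : ℝ) + 1 / 2)) atTop (nhds 0) := by
    simp only [one_div]
    exact tendsto_inv_atTop_zero.comp (tendsto_atTop_add_const_right _ _ tendsto_natCast_atTop_atTop)
  have h2 := (this.const_mul (3 / 8)).const_add (1 / 4)
  rwa [mul_zero, add_zero] at h2

/-- The relation C_{n+1} = 2F_{n+1} + F_n makes the ratio r_n = F_n / C_n satisfy r_{n+1} = 1/2 -
(C_n / C_{n+1}) r_n / 2. As C_n / C_{n+1} → 1/4, this is asymptotically a contraction by 1/8 with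
fixed point 4/9, and the error is O(1/n). -/
theorem tendsto_fineNumber_div_catalan :
    Tendsto (fun n : ℕ => (fineNumber n : ℝ) / catalan n) atTop (nhds (4 / 9)) := by
  have hC : ∀ n, (0 : ℝ) < catalan n := fun n => by exact_mod_cast catalan_pos n
  have hrec : ∀ n, (fineNumber (n + 1) : ℝ) / catalan (n + 1) - 4 / 9 =
      -((n + 2) / (4 * n + 2)) / 2 * ((fineNumber n : ℝ) / catalan n - 4 / 9) -
        1 / (3 * (4 * n + 2)) := by
    intro n
    have h1 : (catalan (n + 1) : ℝ) = 2 * fineNumber (n + 1) + fineNumber n := by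
      exact_mod_cast catalan_succ_eq_fineNumber n
    have h2 : (fineNumber (n + 1) : ℝ) / catalan (n + 1) = 1 / 2 -
        (catalan n / catalan (n + 1)) * (fineNumber n / catalan n) / 2 := by
      have := (hC n).ne'
      have := (hC (n + 1)).ne'
      field_simp
      linarith
    rw [h2, catalan_div_succ]
    field_simp
    ring
  have hb : ∀ n : ℕ, |(fineNumber (n + 1) : ℝ) / catalan (n + 1) - 4 / 9| ≤ 1 / ((n : ℝ) + 2) := by
    intro n
    induction n with
    | zero =>
      have h1 := catalan_succ_eq_fineNumber 0
      rw [zero_add, catalan_one, fineNumber_zero] at h1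
      have : fineNumber 1 = 0 := by omega
      simp [this, abs_le]
      norm_num
    | succ n ih =>
      rw [hrec (n + 1)]
      refine (abs_sub _ _).trans ?_
      rw [abs_mul]
      push_cast
      have e1 : |-(((n : ℝ) + 1 + 2) / (4 * ((n : ℝ) + 1) + 2)) / 2| =
          ((n : ℝ) + 3) / (2 * (4 * n + 6)) := by
        rw [neg_div, abs_neg, abs_of_nonneg (by positivity)]
        field_simp
        ring
      have e2 : |1 / (3 * (4 * ((n : ℝ) + 1) + 2))| = 1 / (3 * (4 * n + 6)) := by
        rw [abs_of_nonneg (by positivity)]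
        ring
      rw [e1, e2]
      calc _ ≤ ((n : ℝ) + 3) / (2 * (4 * n + 6)) * (1 / ((n : ℝ) + 2)) + 1 / (3 * (4 * n + 6)) := by
            gcongr
        _ ≤ _ := by
            rw [div_mul_div_comm, div_add_div _ _ (by positivity) (by positivity),
              div_le_div_iff₀ (by positivity) (by positivity)]
            have : (0 : ℝ) ≤ n := Nat.cast_nonneg n
            nlinarith [pow_nonneg this 2, pow_nonneg this 3, pow_nonneg this 4]
  rw [← tendsto_add_atTop_iff_nat 1, tendsto_iff_norm_sub_tendsto_zero]
  refine squeeze_zero (fun _ => norm_nonneg _) hb ?_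
  simp only [one_div]
  exact tendsto_inv_atTop_zero.comp (tendsto_atTop_add_const_right _ _ tendsto_natCast_atTop_atTop)

theorem tendsto_catalan_div_add (k : ℕ) :
    Tendsto (fun n : ℕ => (catalan n : ℝ) / catalan (k + n)) atTop (nhds ((1 / 4) ^ k)) := by
  have hC : ∀ n, (catalan n : ℝ) ≠ 0 := fun n => by exact_mod_cast (catalan_pos n).ne'
  induction k with
  | zero => simp [hC]
  | succ k ih =>
    have h := ih.mul ((tendsto_add_atTop_iff_nat k).2 tendsto_catalan_div_succ)
    rw [pow_succ]
    refine h.congr fun n => ?_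
    rw [show k + 1 + n = n + k + 1 by ring, show k + n = n + k by ring]
    rw [div_mul_div_cancel₀ (hC _)]

theorem tendsto_fineNumber_div_add (k : ℕ) :
    Tendsto (fun n : ℕ => (fineNumber n : ℝ) / catalan (k + n)) atTop
      (nhds (4 / 9 * (1 / 4) ^ k)) := by
  have hC : ∀ n, (catalan n : ℝ) ≠ 0 := fun n => by exact_mod_cast (catalan_pos n).ne'
  refine (tendsto_fineNumber_div_catalan.mul (tendsto_catalan_div_add k)).congr fun n => ?_
  rw [div_mul_div_cancel₀ (hC _)]

/-- The partial sums telescope to 2 - 2 binom(2n, n) / 4^n, and the square of binom(2n, n) / 4^n is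
at most 1/(n + 1). The value 2 is what makes the Galton–Watson tree almost surely finite. -/
theorem hasSum_catalan_div_four_pow :
    HasSum (fun n : ℕ => (catalan n : ℝ) / 4 ^ n) 2 := by
  have hb : ∀ n : ℕ, (n.centralBinom / 4 ^ n : ℝ) ^ 2 * (n + 1) ≤ 1 := by
    intro n
    induction n with
    | zero => simp
    | succ n ih =>
      have h3 : ((n + 1).centralBinom : ℝ) = 2 * (2 * n + 1) / (n + 1) * n.centralBinom := by
        have : ((n : ℝ) + 1) * (n + 1).centralBinom = 2 * (2 * n + 1) * n.centralBinom := by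
          exact_mod_cast Nat.succ_mul_centralBinom_succ n
        field_simp
        linarith
      refine le_trans ?_ ih
      have e : ((n + 1).centralBinom / 4 ^ (n + 1) : ℝ) ^ 2 * ((n + 1 : ℕ) + 1) =
          (n.centralBinom / 4 ^ n : ℝ) ^ 2 * ((2 * n + 1) ^ 2 * (n + 2) / (4 * (n + 1) ^ 2)) := by
        rw [h3]
        push_cast
        field_simp
        ring
      rw [e]
      gcongr
      rw [div_le_iff₀ (by positivity)]
      have : (0 : ℝ) ≤ n := Nat.cast_nonneg n
      nlinarith
  have hlim : Tendsto (fun n : ℕ => (n.centralBinom / 4 ^ n : ℝ)) atTop (nhds 0) := by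
    have h2 : Tendsto (fun n : ℕ => (n.centralBinom / 4 ^ n : ℝ) ^ 2) atTop (nhds 0) := by
      refine squeeze_zero (fun _ => by positivity) (g := fun n : ℕ => 1 / ((n : ℝ) + 1)) ?_
        tendsto_one_div_add_atTop_nhds_zero_nat
      intro n
      rw [le_div_iff₀ (by positivity)]
      exact hb n
    have h3 := h2.sqrt
    rw [Real.sqrt_zero] at h3
    exact h3.congr fun n => Real.sqrt_sq (by positivity)
  rw [hasSum_iff_tendsto_nat_of_nonneg (fun n => by positivity)]
  have hsum : ∀ n : ℕ, ∑ i ∈ Finset.range n, (catalan i : ℝ) / 4 ^ i =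
      2 - 2 * (n.centralBinom / 4 ^ n) := by
    intro n
    induction n with
    | zero => simp
    | succ n ih =>
      rw [Finset.sum_range_succ, ih]
      have h1 : ((n : ℝ) + 1) * catalan n = n.centralBinom := by
        exact_mod_cast succ_mul_catalan_eq_centralBinom n
      have h3 : ((n : ℝ) + 1) * (n + 1).centralBinom = 2 * (2 * n + 1) * n.centralBinom := by
        exact_mod_cast Nat.succ_mul_centralBinom_succ n
      have h4 : ((n + 1).centralBinom : ℝ) = 2 * (2 * n + 1) * catalan n := by
        have : (n : ℝ) + 1 ≠ 0 := by positivity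
        apply mul_left_cancel₀ this
        linear_combination h3 - 2 * (2 * n + 1) * h1
      rw [h4, ← h1]
      field_simp
      ring
  simp only [hsum]
  simpa using (hlim.const_mul 2).const_sub 2

theorem tsum_catalan_mul_pow : ∑' n : ℕ, (catalan n : ℝ≥0∞) * 4⁻¹ ^ n = 2 := by
  have h := hasSum_catalan_div_four_pow
  have h1 := ENNReal.ofReal_tsum_of_nonneg (fun n => by positivity) h.summable
  rw [h.tsum_eq] at h1
  simp only [ENNReal.ofReal_ofNat] at h1
  rw [h1]
  congr 1
  ext n
  rw [ENNReal.ofReal_div_of_pos (by positivity), ENNReal.ofReal_natCast,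
    ENNReal.ofReal_pow (by positivity), ENNReal.ofReal_ofNat, div_eq_mul_inv, ENNReal.inv_pow]

/-! ### Finite ordered trees as binary trees -/

theorem PNat.eq_one_or_eq_add_one (i : ℕ+) : i = 1 ∨ ∃ k : ℕ+, i = k + 1 := by
  by_cases h : i = 1
  · exact Or.inl h
  · exact Or.inr (PNat.exists_eq_succ_of_ne_one h)

namespace OrderedTree

/-- Closure under elder siblings makes the children an initial segment; for a word without children
the supremum of the empty set is 0. -/
theorem append_mem_iff (t : OrderedTree) (u : List ℕ+) (i : ℕ+) :
    u ++ [i] ∈ t.verts ↔ (i : ℕ) ≤ t.numChildren u := by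
  have hfin := (t.locallyFinite u).image (fun i : ℕ+ => (i : ℕ))
  constructor
  · intro h
    exact le_csSup hfin.bddAbove ⟨i, h, rfl⟩
  · intro h
    have hne : ((fun i : ℕ+ => (i : ℕ)) '' {i : ℕ+ | u ++ [i] ∈ t.verts}).Nonempty := by
      by_contra hempty
      rw [Set.not_nonempty_iff_eq_empty] at hempty
      rw [numChildren, hempty, csSup_empty] at h
      have := i.pos
      simp at h
    obtain ⟨j, hj, hj'⟩ := hne.csSup_mem hfin
    refine t.sibling_mem u j i hj ?_
    rw [← PNat.coe_le_coe]
    exact h.trans_eq hj'.symm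

theorem numChildren_eq_of_forall {t : OrderedTree} {u : List ℕ+} {k : ℕ}
    (h : ∀ i : ℕ+, u ++ [i] ∈ t.verts ↔ (i : ℕ) ≤ k) : t.numChildren u = k := by
  have h' : ∀ i : ℕ+, (i : ℕ) ≤ t.numChildren u ↔ (i : ℕ) ≤ k := fun i => by
    rw [← append_mem_iff, h]
  apply le_antisymm
  · by_contra hlt
    have := (h' (t.numChildren u).toPNat').1
    rw [Nat.toPNat'_coe, if_pos (by omega)] at this
    exact hlt (this le_rfl)
  · by_contra hlt
    have := (h' k.toPNat').2
    rw [Nat.toPNat'_coe, if_pos (by omega)] at this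
    exact hlt (this le_rfl)

/-- The tree with a single vertex. -/
def single : OrderedTree where
  verts := {[]}
  root_mem := rfl
  ancestor_mem v w h := by simp_all
  sibling_mem u i j h := by simp at h
  locallyFinite u := by simp

/-- Membership in the tree whose first child carries the subtree `a` and whose other children form
the tree `b`. -/
def JoinMem (a b : OrderedTree) : List ℕ+ → Prop
  | [] => True
  | i :: u => if i = 1 then u ∈ a.verts else (i - 1) :: u ∈ b.verts

theorem joinMem_one_cons {a b : OrderedTree} {u : List ℕ+} :
    JoinMem a b (1 :: u) ↔ u ∈ a.verts := by simp [JoinMem]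

theorem joinMem_succ_cons {a b : OrderedTree} {u : List ℕ+} {i : ℕ+} :
    JoinMem a b ((i + 1) :: u) ↔ i :: u ∈ b.verts := by
  have : i + 1 ≠ 1 := fun h => by
    have := congrArg PNat.val h
    simp at this
  simp [JoinMem, this, PNat.add_sub]

/-- The tree whose first child carries the subtree `a` and whose other children form `b`. -/
def join (a b : OrderedTree) : OrderedTree where
  verts := {w | JoinMem a b w}
  root_mem := trivial
  ancestor_mem v w h := by
    rcases v with _ | ⟨i, v⟩
    · trivial
    · rcases PNat.eq_one_or_eq_add_one i with rfl | ⟨k, rfl⟩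
      · exact (joinMem_one_cons (b := b)).2 (a.ancestor_mem v w ((joinMem_one_cons (b := b)).1 h))
      · exact (joinMem_succ_cons (a := a)).2 (b.ancestor_mem (k :: v) w ((joinMem_succ_cons (a := a)).1 h))
  sibling_mem u i j h hji := by
    rcases u with _ | ⟨c, u⟩
    · rcases PNat.eq_one_or_eq_add_one j with rfl | ⟨l, rfl⟩
      · exact (joinMem_one_cons (b := b)).2 a.root_mem
      · rcases PNat.eq_one_or_eq_add_one i with rfl | ⟨k, rfl⟩
        · have := PNat.coe_le_coe _ _ |>.2 hji
          simp at this
        · refine (joinMem_succ_cons (a := a)).2 (b.sibling_mem [] k l ((joinMem_succ_cons (a := a)).1 h) ?_)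
          simpa using hji
    · rcases PNat.eq_one_or_eq_add_one c with rfl | ⟨k, rfl⟩
      · exact (joinMem_one_cons (b := b)).2 (a.sibling_mem u i j ((joinMem_one_cons (b := b)).1 h) hji)
      · exact (joinMem_succ_cons (a := a)).2 (b.sibling_mem (k :: u) i j ((joinMem_succ_cons (a := a)).1 h) hji)
  locallyFinite u := by
    rcases u with _ | ⟨c, u⟩
    · refine (((b.locallyFinite []).image (· + 1)).insert 1).subset ?_
      intro i hi
      rcases PNat.eq_one_or_eq_add_one i with rfl | ⟨k, rfl⟩
      · exact Set.mem_insert _ _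
      · exact Set.mem_insert_of_mem _ ⟨k, (joinMem_succ_cons (a := a)).1 hi, rfl⟩
    · rcases PNat.eq_one_or_eq_add_one c with rfl | ⟨k, rfl⟩
      · exact (a.locallyFinite u).subset fun i hi => (joinMem_one_cons (b := b)).1 hi
      · exact (b.locallyFinite (k :: u)).subset fun i hi => (joinMem_succ_cons (a := a)).1 hi

theorem one_cons_mem_join {a b : OrderedTree} {u : List ℕ+} :
    1 :: u ∈ (join a b).verts ↔ u ∈ a.verts := joinMem_one_cons (a := a) (b := b)

theorem succ_cons_mem_join {a b : OrderedTree} {u : List ℕ+} {i : ℕ+} :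
    (i + 1) :: u ∈ (join a b).verts ↔ i :: u ∈ b.verts := joinMem_succ_cons

theorem join_injective {a b a' b' : OrderedTree} (h : join a b = join a' b') :
    a = a' ∧ b = b' := by
  constructor
  · ext u
    rw [← one_cons_mem_join (b := b), h, one_cons_mem_join]
  · ext u
    rcases u with _ | ⟨i, u⟩
    · exact iff_of_true b.root_mem b'.root_mem
    · rw [← succ_cons_mem_join (a := a), h, succ_cons_mem_join]

theorem exists_eq_join {t : OrderedTree} (h : [1] ∈ t.verts) : ∃ a b, t = join a b := by
  let a : OrderedTree :=
    { verts := {u | 1 :: u ∈ t.verts}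
      root_mem := h
      ancestor_mem := fun v w hw => t.ancestor_mem (1 :: v) w hw
      sibling_mem := fun u i j hi hji => t.sibling_mem (1 :: u) i j hi hji
      locallyFinite := fun u => t.locallyFinite (1 :: u) }
  let b : OrderedTree :=
    { verts := {w | w = [] ∨ ∃ i u, w = i :: u ∧ (i + 1) :: u ∈ t.verts}
      root_mem := Or.inl rfl
      ancestor_mem := by
        rintro (_ | ⟨i, v⟩) w hw
        · exact Or.inl rfl
        · rcases hw with hw | ⟨i', u, hw, hu⟩
          · simp at hw
          · simp only [List.cons_append, List.cons.injEq] at hw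
            obtain ⟨rfl, rfl⟩ := hw
            exact Or.inr ⟨i, v, rfl, t.ancestor_mem ((i + 1) :: v) w hu⟩
      sibling_mem := by
        rintro (_ | ⟨c, u⟩) i j hi hji
        · rcases hi with hi | ⟨i', u, hw, hu⟩
          · simp at hi
          · simp only [List.nil_append, List.cons.injEq] at hw
            obtain ⟨rfl, rfl⟩ := hw
            exact Or.inr ⟨j, [], rfl, t.sibling_mem [] (i + 1) (j + 1) hu (by simpa using hji)⟩
        · rcases hi with hi | ⟨i', u', hw, hu⟩
          · simp at hi
          · simp only [List.cons_append, List.cons.injEq] at hw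
            obtain ⟨rfl, rfl⟩ := hw
            exact Or.inr ⟨c, u ++ [j], rfl, t.sibling_mem ((c + 1) :: u) i j hu hji⟩
      locallyFinite := by
        rintro (_ | ⟨c, u⟩)
        · refine Set.Finite.of_finite_image (f := (· + 1)) ((t.locallyFinite []).subset ?_)
            (add_left_injective 1).injOn
          rintro _ ⟨i, hi, rfl⟩
          rcases hi with hi | ⟨i', u, hw, hu⟩
          · simp at hi
          · simp only [List.nil_append, List.cons.injEq] at hw
            obtain ⟨rfl, rfl⟩ := hw
            exact hu
        · refine (t.locallyFinite ((c + 1) :: u)).subset ?_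
          rintro i hi
          rcases hi with hi | ⟨i', u', hw, hu⟩
          · simp at hi
          · simp only [List.cons_append, List.cons.injEq] at hw
            obtain ⟨rfl, rfl⟩ := hw
            exact hu }
  refine ⟨a, b, ?_⟩
  ext w
  rcases w with _ | ⟨i, u⟩
  · exact iff_of_true t.root_mem (join a b).root_mem
  · rcases PNat.eq_one_or_eq_add_one i with rfl | ⟨k, rfl⟩
    · rw [one_cons_mem_join]; rfl
    · rw [succ_cons_mem_join]
      constructor
      · exact fun h => Or.inr ⟨k, u, rfl, h⟩
      · rintro (h | ⟨i, v, h, hv⟩)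
        · simp at h
        · simp only [List.cons.injEq] at h
          obtain ⟨rfl, rfl⟩ := h
          exact hv

/-- The embedding of the words of `b` into those of `join a b`. -/
def succHead : List ℕ+ → List ℕ+
  | [] => []
  | i :: u => (i + 1) :: u

theorem succHead_injective : Function.Injective succHead := by
  rintro (_ | ⟨i, u⟩) (_ | ⟨j, v⟩) h <;> simp_all [succHead]

theorem verts_join (a b : OrderedTree) :
    (join a b).verts = (List.cons 1) '' a.verts ∪ succHead '' b.verts := by
  ext w
  rcases w with _ | ⟨i, u⟩
  · exact iff_of_true (join a b).root_mem (Or.inr ⟨[], b.root_mem, rfl⟩)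
  · rcases PNat.eq_one_or_eq_add_one i with rfl | ⟨k, rfl⟩
    · rw [one_cons_mem_join]
      constructor
      · exact fun h => Or.inl ⟨u, h, rfl⟩
      · rintro (⟨v, hv, h⟩ | ⟨v, hv, h⟩)
        · simp at h; exact h ▸ hv
        · rcases v with _ | ⟨j, v⟩
          · simp [succHead] at h
          · simp only [succHead, List.cons.injEq] at h
            have := congrArg PNat.val h.1
            simp at this
    · rw [succ_cons_mem_join]
      constructor
      · exact fun h => Or.inr ⟨k :: u, h, rfl⟩
      · rintro (⟨v, hv, h⟩ | ⟨v, hv, h⟩)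
        · simp only [List.cons.injEq] at h
          have := congrArg PNat.val h.1
          simp at this
        · rcases v with _ | ⟨j, v⟩
          · simp [succHead] at h
          · simp only [succHead, List.cons.injEq, add_left_inj] at h
            obtain ⟨rfl, rfl⟩ := h
            exact hv

theorem disjoint_cons_succHead (A B : Set (List ℕ+)) :
    Disjoint ((List.cons 1) '' A) (succHead '' B) := by
  rw [Set.disjoint_left]
  rintro _ ⟨u, _, rfl⟩ ⟨v, _, h⟩
  rcases v with _ | ⟨j, v⟩
  · simp [succHead] at h
  · simp only [succHead, List.cons.injEq] at h
    have := congrArg PNat.val h.1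
    simp at this

/-- The root of `b` serves as the root of the joined tree, so no vertex is added. -/
theorem size_join (a b : OrderedTree) : (join a b).size = a.size + b.size := by
  rw [size, verts_join, Set.encard_union_eq (disjoint_cons_succHead _ _),
    (List.cons_injective).encard_image, succHead_injective.encard_image]
  rfl

theorem numChildren_join_cons (a b : OrderedTree) (u : List ℕ+) :
    (join a b).numChildren (1 :: u) = a.numChildren u := by
  refine numChildren_eq_of_forall fun i => ?_
  rw [List.cons_append, one_cons_mem_join, append_mem_iff]

/-- Only the root of `b` changes degree: it gains the root of `a` as its first child. -/
theorem numChildren_join_succHead (a b : OrderedTree) (u : List ℕ+) :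
    (join a b).numChildren (succHead u) = b.numChildren u + if u = [] then 1 else 0 := by
  refine numChildren_eq_of_forall fun i => ?_
  rcases u with _ | ⟨c, u⟩
  · simp only [succHead, List.nil_append, if_true]
    rcases PNat.eq_one_or_eq_add_one i with rfl | ⟨k, rfl⟩
    · rw [one_cons_mem_join]
      simp [a.root_mem]
    · rw [succ_cons_mem_join]
      have := append_mem_iff b [] k
      simpa using this
  · have := append_mem_iff b (c :: u) i
    simpa [succHead, succ_cons_mem_join] using this

/-- The finite ordered tree encoded by a binary tree under the left-child right-sibling
correspondence. -/
def ofBinary : BinaryTree Unit → OrderedTree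
  | .nil => single
  | .node _ l r => join (ofBinary l) (ofBinary r)

theorem size_single : single.size = 1 := Set.encard_singleton _

theorem size_ne_zero (t : OrderedTree) : t.size ≠ 0 :=
  Set.encard_ne_zero.2 ⟨[], t.root_mem⟩

theorem size_ofBinary (x : BinaryTree Unit) : (ofBinary x).size = x.numNodes + 1 := by
  induction x with
  | nil => simp [ofBinary, size_single]
  | node _ l r hl hr =>
    rw [ofBinary, size_join, hl, hr]
    simp only [BinaryTree.numNodes]
    push_cast
    ring

theorem ofBinary_injective : Function.Injective ofBinary := by
  have hne : ∀ a b, single ≠ join a b := by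
    intro a b h
    have h1 : [1] ∈ (join a b).verts := one_cons_mem_join.2 a.root_mem
    rw [← h] at h1
    simp [single] at h1
  intro x
  induction x with
  | nil =>
    rintro (_ | ⟨_, l, r⟩) h
    · rfl
    · exact absurd h (hne _ _)
  | node _ l r hl hr =>
    rintro (_ | ⟨_, l', r'⟩) h
    · exact absurd h.symm (hne _ _)
    · obtain ⟨h1, h2⟩ := join_injective h
      rw [hl h1, hr h2]

theorem eq_single_or_one_mem (t : OrderedTree) : t = single ∨ [1] ∈ t.verts := by
  by_cases h : [1] ∈ t.verts
  · exact Or.inr h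
  · refine Or.inl (OrderedTree.ext (Set.Subset.antisymm ?_ ?_))
    · rintro (_ | ⟨i, u⟩) hu
      · rfl
      · exact absurd (t.sibling_mem [] i 1 (t.ancestor_mem [i] u hu) one_le) h
    · rintro _ rfl
      exact t.root_mem

/-- Both parts of a join have at least one vertex, so each is strictly smaller than the whole and
the induction applies. -/
theorem exists_ofBinary_eq {t : OrderedTree} {n : ℕ} (h : t.size = n + 1) :
    ∃ x, ofBinary x = t := by
  induction n using Nat.strong_induction_on generalizing t with
  | _ n ih =>
    rcases eq_single_or_one_mem t with rfl | h1
    · exact ⟨.nil, rfl⟩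
    · obtain ⟨a, b, rfl⟩ := exists_eq_join h1
      rw [size_join] at h
      have ha : a.size ≠ ⊤ := fun h' => by
        rw [h', top_add] at h; exact absurd h.symm (ENat.natCast_ne_top (n + 1))
      have hb : b.size ≠ ⊤ := fun h' => by
        rw [h', add_top] at h; exact absurd h.symm (ENat.natCast_ne_top (n + 1))
      obtain ⟨p, hp⟩ := ENat.ne_top_iff_exists.1 ha
      obtain ⟨q, hq⟩ := ENat.ne_top_iff_exists.1 hb
      have hp0 : p ≠ 0 := fun h0 => a.size_ne_zero (by rw [← hp, h0]; rfl)
      have hq0 : q ≠ 0 := fun h0 => b.size_ne_zero (by rw [← hq, h0]; rfl)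
      rw [← hp, ← hq] at h
      have hpq : p + q = n + 1 := by exact_mod_cast h
      obtain ⟨p, rfl⟩ := Nat.exists_eq_succ_of_ne_zero hp0
      obtain ⟨q, rfl⟩ := Nat.exists_eq_succ_of_ne_zero hq0
      obtain ⟨x, rfl⟩ := ih p (by omega) (t := a) (by rw [← hp]; simp)
      obtain ⟨y, rfl⟩ := ih q (by omega) (t := b) (by rw [← hq]; simp)
      exact ⟨.node () x y, rfl⟩

theorem geomHalf_apply (n : ℕ) : geomHalf n = (2⁻¹ : ℝ≥0∞) ^ (n + 1) := rfl

/-- The Galton–Watson weight of a finite tree depends only on its number of vertices. -/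
theorem exists_finset_prod_geomHalf (x : BinaryTree Unit) :
    ∃ F : Finset (List ℕ+), (F : Set (List ℕ+)) = (ofBinary x).verts ∧
      ∏ u ∈ F, geomHalf ((ofBinary x).numChildren u) = 2⁻¹ ^ (2 * x.numNodes + 1) := by
  classical
  induction x with
  | nil =>
    refine ⟨{[]}, by simp [ofBinary, single], ?_⟩
    have : (ofBinary .nil).numChildren [] = 0 :=
      numChildren_eq_of_forall fun i => by simp [ofBinary, single]
    simp [this, geomHalf_apply]
  | node _ l r hl hr =>
    obtain ⟨A, hA, hA'⟩ := hl
    obtain ⟨B, hB, hB'⟩ := hr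
    refine ⟨A.image (List.cons 1) ∪ B.image succHead, ?_, ?_⟩
    · rw [ofBinary, verts_join, Finset.coe_union, Finset.coe_image, Finset.coe_image, hA, hB]
    · rw [Finset.prod_union, Finset.prod_image List.cons_injective.injOn,
        Finset.prod_image succHead_injective.injOn]
      · simp only [ofBinary, numChildren_join_cons, numChildren_join_succHead, hA']
        -- The additional child of the root costs one factor 1/2, so the exponents combine as (2p +
        -- 1) + (2q + 1) + 1 = 2(p + q + 1) + 1.
        have h1 : ∀ u : List ℕ+, geomHalf ((ofBinary r).numChildren u + if u = [] then 1 else 0) =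
            geomHalf ((ofBinary r).numChildren u) * if u = [] then 2⁻¹ else 1 := by
          intro u
          split_ifs
          · rw [geomHalf_apply, geomHalf_apply, pow_succ]
          · simp
        have h2 : ([] : List ℕ+) ∈ B := by
          rw [← Finset.mem_coe, hB]; exact (ofBinary r).root_mem
        simp only [h1, Finset.prod_mul_distrib, hB', Finset.prod_ite_eq', h2, if_true,
          BinaryTree.numNodes]
        rw [← pow_succ, ← pow_add]
        congr 1
        ring
      · rw [← Finset.disjoint_coe, Finset.coe_image, Finset.coe_image]
        exact disjoint_cons_succHead _ _

theorem tprod_geomHalf (x : BinaryTree Unit) :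
    ∏' u : (ofBinary x).verts, geomHalf ((ofBinary x).numChildren u) =
      2⁻¹ ^ (2 * x.numNodes + 1) := by
  obtain ⟨F, hF, hF'⟩ := exists_finset_prod_geomHalf x
  rw [← hF', ← Finset.tprod_subtype' F (fun u => geomHalf ((ofBinary x).numChildren u)), hF]

/-- Points are closed: the degrees determine the tree, with -1 marking absent words, and each degree
is continuous in the tree. -/
instance : MeasurableSingletonClass OrderedTree := by
  refine ⟨fun t => IsClosed.measurableSet ?_⟩
  have h : ({t} : Set OrderedTree) = ⋂ u : List ℕ+, {s | s.deg u = t.deg u} := by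
    ext s
    simp only [Set.mem_singleton_iff, Set.mem_iInter]
    constructor
    · rintro rfl u; rfl
    · intro h
      ext u
      have h1 := h u
      simp only [Set.mem_ofPred_eq, deg] at h1
      by_cases h2 : u ∈ s.verts <;> by_cases h3 : u ∈ t.verts <;> simp [h2, h3] at h1 ⊢
  rw [h]
  refine isClosed_iInter fun u => ?_
  have hc : Continuous fun s : OrderedTree => s.deg u :=
    (continuous_apply u).comp
      (continuous_induced_dom (f := fun (t : OrderedTree) u => t.deg u))
  exact isClosed_eq hc continuous_const

/-! ### The law of the number of vertices of a Galton–Watson tree -/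

/-- The number of vertices as a natural number, with value zero for infinite trees. -/
noncomputable def natSize (t : OrderedTree) : ℕ := t.size.toNat

theorem natSize_eq_succ_iff (t : OrderedTree) (n : ℕ) :
    t.natSize = n + 1 ↔ t.size = n + 1 := by
  rw [natSize]
  constructor
  · intro h
    have h1 : t.size ≠ ⊤ := fun h' => by rw [h'] at h; simp at h
    rw [← ENat.natCast_toNat h1, h]
    simp
  · intro h
    rw [h]
    rfl

theorem natSize_eq_zero_iff (t : OrderedTree) : t.natSize = 0 ↔ t.size = ⊤ := by
  rw [natSize, ENat.toNat_eq_zero]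
  simp [t.size_ne_zero]

theorem natSize_preimage (n : ℕ) : {t : OrderedTree | t.natSize = n + 1} =
    ((BinaryTree.treesOfNumNodesEq n).map ⟨ofBinary, ofBinary_injective⟩ : Finset OrderedTree) := by
  ext t
  simp only [Set.mem_ofPred_eq, natSize_eq_succ_iff, Finset.coe_map, Function.Embedding.coeFn_mk,
    Set.mem_image, Finset.mem_coe, BinaryTree.mem_treesOfNumNodesEq]
  constructor
  · intro h
    obtain ⟨x, rfl⟩ := exists_ofBinary_eq h
    rw [size_ofBinary] at h
    have h1 : x.numNodes + 1 = n + 1 := by exact_mod_cast h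
    exact ⟨x, by omega, rfl⟩
  · rintro ⟨x, rfl, rfl⟩
    exact size_ofBinary x

theorem measurable_natSize : Measurable natSize := by
  have h : ∀ n : ℕ, MeasurableSet {t : OrderedTree | t.natSize = n + 1} := fun n => by
    rw [natSize_preimage]
    exact Finset.measurableSet _
  refine measurable_to_countable' fun n => ?_
  rcases n with _ | n
  · have : natSize ⁻¹' {0} = (⋃ n : ℕ, {t : OrderedTree | t.natSize = n + 1})ᶜ := by
      ext t
      simp only [Set.mem_preimage, Set.mem_singleton_iff, Set.mem_compl_iff, Set.mem_iUnion,
        Set.mem_ofPred_eq, not_exists]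
      constructor
      · intro h n; omega
      · intro h
        by_contra h0
        exact h (t.natSize - 1) (by omega)
    rw [this]
    exact (MeasurableSet.iUnion h).compl
  · exact h n

end OrderedTree

theorem IsGaltonWatsonTree.measure_natSize {Ω : Type*} [MeasurableSpace Ω] {μ : Measure Ω}
    {T : Ω → OrderedTree} (hT : IsGaltonWatsonTree geomHalf T μ) (n : ℕ) :
    μ {ω | (T ω).natSize = n + 1} = catalan n * 2⁻¹ ^ (2 * n + 1) := by
  have h1 : {ω | (T ω).natSize = n + 1} = T ⁻¹' {t | t.natSize = n + 1} := rfl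
  rw [h1, OrderedTree.natSize_preimage,
    ← sum_measure_preimage_singleton _ (fun y _ => hT.1 (measurableSet_singleton y)),
    Finset.sum_map]
  have h2 : ∀ x ∈ BinaryTree.treesOfNumNodesEq n,
      μ (T ⁻¹' {OrderedTree.ofBinary x}) = 2⁻¹ ^ (2 * n + 1) := by
    intro x hx
    rw [hT.2, OrderedTree.tprod_geomHalf, BinaryTree.mem_treesOfNumNodesEq.1 hx]
  refine (Finset.sum_congr rfl h2).trans ?_
  rw [Finset.sum_const, BinaryTree.treesOfNumNodesEq_card_eq_catalan,
    nsmul_eq_mul]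

/-- The finite sizes already carry mass (1/2) ∑ C_n 4^{-n} = 1, leaving nothing for infinite trees.
-/
theorem IsGaltonWatsonTree.ae_natSize_ne_zero {Ω : Type*} [MeasurableSpace Ω] {μ : Measure Ω}
    [IsProbabilityMeasure μ] {T : Ω → OrderedTree} (hT : IsGaltonWatsonTree geomHalf T μ) :
    ∀ᵐ ω ∂μ, (T ω).natSize ≠ 0 := by
  have hm : Measurable fun ω => (T ω).natSize := OrderedTree.measurable_natSize.comp hT.1
  have h1 : {ω | (T ω).natSize ≠ 0} = ⋃ n : ℕ, {ω | (T ω).natSize = n + 1} := by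
    ext ω
    simp only [Set.mem_ofPred_eq, Set.mem_iUnion]
    exact ⟨fun h => ⟨(T ω).natSize - 1, by omega⟩, fun ⟨n, hn⟩ => by omega⟩
  have hms : ∀ n : ℕ, MeasurableSet {ω | (T ω).natSize = n + 1} := fun n =>
    hm (measurableSet_singleton (n + 1))
  have h2 : μ {ω | (T ω).natSize ≠ 0} = 1 := by
    rw [h1, measure_iUnion _ hms]
    · simp only [hT.measure_natSize]
      have h3 : ∀ n : ℕ, (catalan n : ℝ≥0∞) * 2⁻¹ ^ (2 * n + 1) =
          (catalan n * 4⁻¹ ^ n) * 2⁻¹ := by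
        intro n
        rw [pow_succ, pow_mul, mul_assoc, ← ENNReal.inv_pow]
        norm_num
      simp only [h3]
      rw [ENNReal.tsum_mul_right, tsum_catalan_mul_pow]
      exact ENNReal.mul_inv_cancel two_ne_zero ENNReal.ofNat_ne_top
    · intro i j hij
      rw [Function.onFun, Set.disjoint_left]
      intro ω h h'
      simp only [Set.mem_ofPred_eq] at h h'
      omega
  rw [ae_iff_measure_eq, h2, measure_univ]
  rw [h1]
  exact (MeasurableSet.iUnion hms).nullMeasurableSet

/-! ### Weights of sequences with given positions of parts of size one -/

/-- The weight `C_{s-1} 4^{-s}` of a part of size `s`. -/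
noncomputable def partWeight : ℕ → ℝ≥0∞
  | 0 => 0
  | n + 1 => catalan n * 4⁻¹ ^ (n + 1)

theorem partWeight_zero : partWeight 0 = 0 := rfl

/-- The weight of a finite sequence of parts. -/
noncomputable def listWeight (u : List ℕ) : ℝ≥0∞ := (u.map partWeight).prod

/-- The positions of the parts of size one when the parts are laid out consecutively. -/
def hillSet : List ℕ → Finset ℕ
  | [] => ∅
  | s :: u => (if s = 1 then {0} else ∅) ∪ (hillSet u).map (addLeftEmbedding s)

open Classical in
/-- The total weight of the sequences with a given set of hill positions. -/
noncomputable def hillWeight (A : Finset ℕ) : ℝ≥0∞ :=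
  ∑' u : List ℕ, if hillSet u = A then listWeight u else 0

theorem tsum_list (f : List ℕ → ℝ≥0∞) : ∑' u, f u = f [] + ∑' s, ∑' u, f (s :: u) := by
  let e : Unit ⊕ (ℕ × List ℕ) ≃ List ℕ :=
    { toFun := Sum.elim (fun _ => []) fun p => p.1 :: p.2
      invFun := fun l => match l with
        | [] => Sum.inl ()
        | s :: u => Sum.inr (s, u)
      left_inv := by rintro (_ | ⟨s, u⟩) <;> rfl
      right_inv := by rintro (_ | ⟨s, u⟩) <;> rfl }
  rw [← e.tsum_eq, ENNReal.summable.tsum_sum ENNReal.summable]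
  simp only [tsum_fintype, Finset.univ_unique, Finset.sum_singleton]
  rw [← ENNReal.tsum_prod]
  rfl

theorem hillSet_one_cons_eq_iff (u : List ℕ) (g : ℕ) (G : List ℕ) :
    hillSet (1 :: u) = posSet (g :: G) ↔ g = 0 ∧ hillSet u = posSet G := by
  constructor
  · intro h
    have h0 : 0 ∈ posSet (g :: G) := by rw [← h]; simp [hillSet]
    have hg : g = 0 := by
      simp [posSet] at h0
      exact h0.symm
    subst hg
    refine ⟨rfl, ?_⟩
    simp only [hillSet, posSet, if_true, zero_add] at h
    exact ((union_map_addLeft_inj (k := 1) (by simp) (by simp)).1 h).2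
  · rintro ⟨rfl, h⟩
    simp [hillSet, posSet, h]

theorem hillSet_cons_eq_empty_iff (s : ℕ) (u : List ℕ) :
    hillSet (s :: u) = ∅ ↔ s ≠ 1 ∧ hillSet u = ∅ := by
  by_cases h : s = 1 <;> simp [hillSet, h]

/-- A first part of size at least two leaves no hill; it only shifts the others, so it must fit
inside the first gap, which it shortens. -/
theorem hillSet_add_two_cons_eq_iff (s : ℕ) (u : List ℕ) (g : ℕ) (G : List ℕ) :
    hillSet ((s + 2) :: u) = posSet (g :: G) ↔
      s + 2 ≤ g ∧ hillSet u = posSet ((g - (s + 2)) :: G) := by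
  have h1 : hillSet ((s + 2) :: u) = (hillSet u).map (addLeftEmbedding (s + 2)) := by
    simp [hillSet]
  have h2 : s + 2 ≤ g → posSet (g :: G) =
      (posSet ((g - (s + 2)) :: G)).map (addLeftEmbedding (s + 2)) := by
    intro h
    obtain ⟨d, rfl⟩ := Nat.exists_eq_add_of_le h
    simp only [posSet, Nat.add_sub_cancel_left, Finset.map_union, Finset.map_map,
      Finset.map_singleton, addLeftEmbedding_apply]
    congr 2
    ext x
    simp [add_assoc]
  rw [h1]
  constructor
  · intro h
    have hg : g ∈ (hillSet u).map (addLeftEmbedding (s + 2)) := by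
      rw [h]; simp [posSet]
    obtain ⟨y, _, hy⟩ := Finset.mem_map.1 hg
    have hle : s + 2 ≤ g := by
      rw [← hy]; simp
    exact ⟨hle, Finset.map_injective _ (h.trans (h2 hle))⟩
  · rintro ⟨hle, h⟩
    rw [h2 hle, h]

theorem hillWeight_eq (A : Finset ℕ) : hillWeight A = (if A = ∅ then 1 else 0) +
    ∑' s, partWeight s * ∑' u, open Classical in if hillSet (s :: u) = A then listWeight u else 0 := by
  classical
  rw [hillWeight, tsum_list]
  congr 1
  · simp [hillSet, listWeight, eq_comm]
  · congr 1
    ext s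
    rw [← ENNReal.tsum_mul_left]
    congr 1
    ext u
    split_ifs <;> simp [listWeight]

theorem four_inv_eq : (4⁻¹ : ℝ≥0∞) = 2⁻¹ * 2⁻¹ := by
  rw [← ENNReal.mul_inv (by simp) (by simp)]
  norm_num

/-- Splitting off the first part, which must have size at least two, gives x = 1 + x/4, since all
parts together weigh 1/2 and the part of size one weighs 1/4. Finiteness is assumed because `⊤`
solves the equation as well. -/
theorem hillWeight_empty (hfin : hillWeight ∅ ≠ ⊤) : hillWeight ∅ = 4 / 3 := by
  classical
  have hs : ∀ s, (∑' u, if hillSet (s :: u) = ∅ then listWeight u else 0) =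
      if s = 1 then 0 else hillWeight ∅ := by
    intro s
    by_cases h : s = 1 <;> simp [hillSet_cons_eq_empty_iff, h, hillWeight]
  have h := hillWeight_eq ∅
  simp only [hs, if_true] at h
  have h2 : ∑' n : ℕ, partWeight (n + 1) = 2⁻¹ := by
    have : ∀ n : ℕ, partWeight (n + 1) = (catalan n * 4⁻¹ ^ n) * 4⁻¹ := fun n => by
      rw [partWeight, pow_succ, mul_assoc]
    simp only [this]
    rw [ENNReal.tsum_mul_right, tsum_catalan_mul_pow, four_inv_eq, ← mul_assoc,
      ENNReal.mul_inv_cancel two_ne_zero ENNReal.ofNat_ne_top, one_mul]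
  have h3 : ∑' n : ℕ, partWeight (n + 2) = 4⁻¹ := by
    rw [tsum_eq_zero_add' ENNReal.summable] at h2
    have h4 : partWeight (0 + 1) = 4⁻¹ := by simp [partWeight]
    rw [h4] at h2
    have h5 : (2⁻¹ : ℝ≥0∞) = 4⁻¹ + 4⁻¹ := by
      rw [four_inv_eq, ← mul_add, ENNReal.inv_two_add_inv_two, mul_one]
    rw [h5] at h2
    exact (ENNReal.add_right_inj (by simp)).1 h2
  rw [tsum_eq_zero_add' ENNReal.summable, tsum_eq_zero_add' ENNReal.summable] at h
  simp only [partWeight_zero, zero_mul, zero_add] at h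
  have h6 : ∀ n : ℕ, partWeight (n + 1 + 1) * (if n + 1 + 1 = 1 then 0 else hillWeight ∅) =
      partWeight (n + 2) * hillWeight ∅ := fun n => by simp
  simp only [h6] at h
  rw [ENNReal.tsum_mul_right, h3] at h
  simp only [if_true, mul_zero, zero_add] at h
  lift hillWeight ∅ to NNReal using hfin with x hx
  have h7 : (x : ℝ) = 1 + 4⁻¹ * x := by
    have := congrArg ENNReal.toReal h
    rw [ENNReal.toReal_add (by simp) (by finiteness)] at this
    simpa using this
  have h8 : (x : ℝ) = 4 / 3 := by linarith
  have h9 : x = 4 / 3 := by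
    apply NNReal.coe_injective
    simpa using h8
  rw [h9, ENNReal.coe_div (by simp)]
  norm_num

/-- Conditioning on the first part: size one is possible only if the gap is empty, size `i + 2`
shortens the gap, and size zero has weight zero. This is the recursion `fineNumber_succ` with powers
of 1/4 attached. -/
theorem hillWeight_posSet_cons (g : ℕ) (G : List ℕ) :
    hillWeight (posSet (g :: G)) = fineNumber g * 4⁻¹ ^ (g + 1) * hillWeight (posSet G) := by
  classical
  induction g using Nat.strong_induction_on with
  | _ g ih =>
    have hne : posSet (g :: G) ≠ ∅ := fun h => by
      have : g ∈ posSet (g :: G) := by simp [posSet]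
      rw [h] at this
      simp at this
    rw [hillWeight_eq, if_neg hne, zero_add, tsum_eq_zero_add' ENNReal.summable,
      tsum_eq_zero_add' ENNReal.summable]
    simp only [partWeight, zero_mul, zero_add]
    have h1 : (∑' u, if hillSet (1 :: u) = posSet (g :: G) then listWeight u else 0) =
        if g = 0 then hillWeight (posSet G) else 0 := by
      by_cases h : g = 0 <;> simp [hillSet_one_cons_eq_iff, h, hillWeight]
    have h2 : ∀ n, (∑' u, if hillSet ((n + 1 + 1) :: u) = posSet (g :: G) then listWeight u else 0) =
        if n + 2 ≤ g then hillWeight (posSet ((g - (n + 2)) :: G)) else 0 := by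
      intro n
      by_cases h : n + 2 ≤ g <;> simp [hillSet_add_two_cons_eq_iff, h, hillWeight]
    rw [h1]
    simp only [h2]
    rcases g with _ | g
    · simp [fineNumber_zero]
    · rw [tsum_eq_sum (s := Finset.range g)]
      · simp only [Nat.add_eq_zero_iff, one_ne_zero, and_false, if_false, mul_zero, zero_add]
        rw [fineNumber_succ, Nat.cast_sum, Finset.sum_mul, Finset.sum_mul]
        refine Finset.sum_congr rfl fun i hi => ?_
        have hi := Finset.mem_range.1 hi
        rw [if_pos (by omega), ih _ (by omega), show g + 1 - (i + 2) = g - 1 - i by omega,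
          show g + 1 + 1 = (i + 1 + 1) + (g - 1 - i + 1) by omega, pow_add]
        push_cast
        ring
      · intro i hi
        rw [Finset.mem_range] at hi
        rw [if_neg (by omega), mul_zero]

theorem hillWeight_posSet (hfin : hillWeight ∅ ≠ ⊤) (G : List ℕ) :
    hillWeight (posSet G) = 4 / 3 * (4⁻¹ ^ gapLength G * (G.map fineNumber).prod) := by
  induction G with
  | nil => simp [posSet, gapLength, hillWeight_empty hfin]
  | cons g G ih =>
    rw [hillWeight_posSet_cons, ih, gapLength, List.map_cons, List.prod_cons, pow_add]
    push_cast
    ring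

/-! ### The joint law of the tree sizes on the two sides of the spine -/

/-- The sizes of the trees to the left of the spine, from left to right. -/
noncomputable def leftList (t : ℕ+ → OrderedTree) (N : ℕ+) : List ℕ :=
  List.ofFn fun i : Fin (N - 1 : ℕ) => (t (Nat.succPNat i)).natSize

/-- The sizes of the trees to the right of the spine, from right to left. -/
noncomputable def rightList (t : ℕ+ → OrderedTree) (X N : ℕ+) : List ℕ :=
  List.ofFn fun i : Fin (X - N : ℕ) => (t (Nat.toPNat' (X - i))).natSize

theorem ofFn_eq_iff {k : ℕ} (f : ℕ → ℕ) (u : List ℕ) :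
    (List.ofFn fun i : Fin k => f i) = u ↔
      k = u.length ∧ ∀ i : Fin u.length, f i = u[i] := by
  constructor
  · rintro rfl
    exact ⟨by simp, fun i => by simp⟩
  · rintro ⟨rfl, h⟩
    refine List.ext_getElem (by simp) fun i h1 h2 => ?_
    simpa using h ⟨i, h2⟩

theorem leftList_eq_iff (t : ℕ+ → OrderedTree) (N : ℕ+) (u : List ℕ) :
    leftList t N = u ↔ (N : ℕ) - 1 = u.length ∧
      ∀ i : Fin u.length, (t (Nat.succPNat i)).natSize = u[i] :=
  ofFn_eq_iff (fun i => (t (Nat.succPNat i)).natSize) u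

theorem rightList_eq_iff (t : ℕ+ → OrderedTree) (X N : ℕ+) (u : List ℕ) :
    rightList t X N = u ↔ (X : ℕ) - N = u.length ∧
      ∀ i : Fin u.length, (t (Nat.toPNat' (X - i))).natSize = u[i] :=
  ofFn_eq_iff (fun i => (t (Nat.toPNat' (X - i))).natSize) u

theorem IsGaltonWatsonTree.measure_natSize_eq {Ω : Type*} [MeasurableSpace Ω] {μ : Measure Ω}
    [IsProbabilityMeasure μ] {T : Ω → OrderedTree} (hT : IsGaltonWatsonTree geomHalf T μ) (n : ℕ) :
    μ (T ⁻¹' {t | t.natSize = n}) = 2 * partWeight n := by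
  rcases n with _ | n
  · rw [partWeight_zero, mul_zero]
    have := hT.ae_natSize_ne_zero
    rw [ae_iff] at this
    simpa using this
  · refine (hT.measure_natSize n).trans ?_
    have h : (4⁻¹ : ℝ≥0∞) ^ (n + 1) = 2⁻¹ ^ (2 * n + 1) * 2⁻¹ := by
      rw [four_inv_eq, ← pow_two, ← pow_mul, ← pow_succ]
      ring_nf
    rw [partWeight, h, mul_comm (2 : ℝ≥0∞) (_ * _), mul_assoc, mul_assoc,
      ENNReal.inv_mul_cancel two_ne_zero ENNReal.ofNat_ne_top, mul_one]

section Spine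

variable {Ω : Type*} [MeasurableSpace Ω] {μ : Measure Ω} [IsProbabilityMeasure μ]
    {T : ℕ+ → Ω → OrderedTree} {X N : Ω → ℕ+}

/-- The size-biasing factor `k` cancels the uniform probability 1/k, so the joint law depends on `k`
alone and the tree counts on the two sides are independent geometric variables. -/
theorem measure_size_biased_pair
    (hX_meas : Measurable X)
    (hX : ∀ k : ℕ+, μ (X ⁻¹' {k}) = sizeBiased geomHalf k)
    (hN : ∀ k m : ℕ+, m ≤ k → (cond μ (X ⁻¹' {k})) (N ⁻¹' {m}) = (k : ℝ≥0∞)⁻¹)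
    {k m : ℕ+} (hmk : m ≤ k) : μ (X ⁻¹' {k} ∩ N ⁻¹' {m}) = 2⁻¹ ^ ((k : ℕ) + 1) := by
  rw [← cond_mul_eq_inter (hX_meas (measurableSet_singleton k)), hN k m hmk, hX k, sizeBiased,
    ← mul_assoc, ENNReal.inv_mul_cancel (by simp) (by simp), one_mul]
  rfl

/-- The k conditional masses 1/k already add up to one. The bound matters because the truncated
difference X - N would otherwise misreport the number of trees on the right. -/
theorem ae_le_of_cond_uniform
    (hX_meas : Measurable X) (hN_meas : Measurable N)
    (hN : ∀ k m : ℕ+, m ≤ k → (cond μ (X ⁻¹' {k})) (N ⁻¹' {m}) = (k : ℝ≥0∞)⁻¹) :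
    ∀ᵐ ω ∂μ, N ω ≤ X ω := by
  have hk : ∀ k : ℕ+, ∀ᵐ ω ∂μ, X ω = k → N ω ≤ k := by
    intro k
    have hms := hX_meas (measurableSet_singleton k)
    by_cases h0 : μ (X ⁻¹' {k}) = 0
    · rw [ae_iff]
      refine measure_mono_null ?_ h0
      intro ω hω
      simp at hω
      exact hω.1
    · have := cond_isProbabilityMeasure h0
      have h1 : cond μ (X ⁻¹' {k}) (N ⁻¹' (Finset.Icc 1 k : Finset ℕ+)) = 1 := by
        rw [← sum_measure_preimage_singleton _ (fun y _ => hN_meas (measurableSet_singleton y)),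
          Finset.sum_congr rfl fun m hm => hN k m (Finset.mem_Icc.1 hm).2, Finset.sum_const]
        rw [PNat.card_Icc, nsmul_eq_mul]
        simp only [PNat.one_coe, Nat.add_sub_cancel]
        exact ENNReal.mul_inv_cancel (by simp) (by simp)
      have h2 : cond μ (X ⁻¹' {k}) (N ⁻¹' (Finset.Icc 1 k : Finset ℕ+))ᶜ = 0 := by
        rw [prob_compl_eq_zero_iff (hN_meas (Finset.measurableSet _))]
        exact h1
      rw [ae_iff]
      have h3 := cond_mul_eq_inter hms (N ⁻¹' (Finset.Icc 1 k : Finset ℕ+))ᶜ μ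
      rw [h2, zero_mul] at h3
      refine measure_mono_null ?_ h3.symm
      intro ω hω
      simp at hω ⊢
      exact hω
  filter_upwards [ae_all_iff.2 hk] with ω hω using hω _ rfl

theorem measure_leftList_rightList
    (hT : ∀ j, IsGaltonWatsonTree geomHalf (T j) μ)
    (hT_indep : iIndepFun T μ)
    (hX_meas : Measurable X) (hN_meas : Measurable N)
    (hX : ∀ k : ℕ+, μ (X ⁻¹' {k}) = sizeBiased geomHalf k)
    (hN : ∀ k m : ℕ+, m ≤ k → (cond μ (X ⁻¹' {k})) (N ⁻¹' {m}) = (k : ℝ≥0∞)⁻¹)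
    (hXN_indep : IndepFun (fun ω => (X ω, N ω)) (fun ω j => T j ω) μ) (u v : List ℕ) :
    μ {ω | leftList (fun j => T j ω) (N ω) = u ∧ rightList (fun j => T j ω) (X ω) (N ω) = v} =
      4⁻¹ * (listWeight u * listWeight v) := by
  set m : ℕ+ := Nat.succPNat u.length with hm
  set k : ℕ+ := Nat.succPNat (u.length + v.length) with hk
  have hm' : (m : ℕ) = u.length + 1 := rfl
  have hk' : (k : ℕ) = u.length + v.length + 1 := rfl
  let g : Fin u.length ⊕ Fin v.length → ℕ+ :=
    Sum.elim (fun i => Nat.succPNat i) (fun i => Nat.toPNat' ((k : ℕ) - i))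
  let c : Fin u.length ⊕ Fin v.length → ℕ := Sum.elim (fun i => u[i]) (fun i => v[i])
  -- The left labels are at most `u.length` and the right ones at least `u.length + 2`; the spine
  -- label between them is never used.
  have hg : Function.Injective g := by
    have hv : ∀ i : Fin v.length, (Nat.toPNat' ((k : ℕ) - i) : ℕ) = k - i := fun i => by
      rw [Nat.toPNat'_coe, if_pos (by omega)]
    rintro (i | i) (j | j) h
    · have := congrArg PNat.val h
      simp only [g, Sum.elim_inl, Nat.succPNat_coe] at this
      exact congrArg _ (Fin.ext (by simpa using this))
    · have := congrArg PNat.val h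
      simp only [g, Sum.elim_inl, Sum.elim_inr] at this
      rw [show PNat.val (Nat.toPNat' ((k : ℕ) - j)) = k - j from hv j] at this
      have h2 : PNat.val (Nat.succPNat (i : ℕ)) = i + 1 := rfl
      omega
    · have := congrArg PNat.val h
      simp only [g, Sum.elim_inl, Sum.elim_inr] at this
      rw [show PNat.val (Nat.toPNat' ((k : ℕ) - i)) = k - i from hv i] at this
      have h2 : PNat.val (Nat.succPNat (j : ℕ)) = j + 1 := rfl
      omega
    · have := congrArg PNat.val h
      simp only [g, Sum.elim_inr] at this
      rw [show PNat.val (Nat.toPNat' ((k : ℕ) - i)) = k - i from hv i,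
        show PNat.val (Nat.toPNat' ((k : ℕ) - j)) = k - j from hv j] at this
      exact congrArg _ (Fin.ext (by omega))
  let S : Set (ℕ+ → OrderedTree) := {t | ∀ i, (t (g i)).natSize = c i}
  have hS : MeasurableSet S := by
    have : S = ⋂ i, (fun t : ℕ+ → OrderedTree => (t (g i)).natSize) ⁻¹' {c i} := by
      ext t; simp [S]
    rw [this]
    exact MeasurableSet.iInter fun i =>
      (OrderedTree.measurable_natSize.comp (measurable_pi_apply (g i))) (measurableSet_singleton _)
  have hev : {ω | leftList (fun j => T j ω) (N ω) = u ∧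
      rightList (fun j => T j ω) (X ω) (N ω) = v} =ᵐ[μ]
      (((fun ω => (X ω, N ω)) ⁻¹' {(k, m)} ∩ (fun ω j => T j ω) ⁻¹' S : Set Ω)) := by
    refine eventuallyEq_set.2 ?_
    filter_upwards [ae_le_of_cond_uniform hX_meas hN_meas hN] with ω hω
    have hω' : (N ω : ℕ) ≤ X ω := hω
    have hNpos := (N ω).pos
    simp only [Set.mem_ofPred_eq, leftList_eq_iff, rightList_eq_iff, Set.mem_inter_iff,
      Set.mem_preimage, Set.mem_singleton_iff, Prod.mk.injEq, S, Sum.forall, g, c, Sum.elim_inl,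
      Sum.elim_inr]
    constructor
    · rintro ⟨⟨h1, h2⟩, h3, h4⟩
      have hXk : X ω = k := PNat.eq (by omega)
      rw [hXk] at h4
      exact ⟨⟨hXk, PNat.eq (by omega)⟩, h2, h4⟩
    · rintro ⟨⟨h1, h2⟩, h3, h4⟩
      rw [h1, h2]
      exact ⟨⟨by omega, h3⟩, by omega, h4⟩
  rw [measure_congr hev, hXN_indep.measure_inter_preimage_eq_mul _ _ (measurableSet_singleton _) hS]
  have h1 : (fun ω => (X ω, N ω)) ⁻¹' {(k, m)} = X ⁻¹' {k} ∩ N ⁻¹' {m} := by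
    ext ω; simp
  have h2 : (fun ω j => T j ω) ⁻¹' S =
      ⋂ i ∈ Finset.univ, T (g i) ⁻¹' {t | t.natSize = c i} := by
    ext ω; simp [S]
  rw [h1, measure_size_biased_pair hX_meas hX hN (by rw [← PNat.coe_le_coe]; omega), h2,
    (hT_indep.precomp hg).measure_inter_preimage_eq_mul Finset.univ
      (sets := fun i => {t | t.natSize = c i})
      (fun i _ => OrderedTree.measurable_natSize (measurableSet_singleton (c i)))]
  simp only [(hT _).measure_natSize_eq, Fintype.prod_sum_type, c, Sum.elim_inl, Sum.elim_inr,
    Finset.prod_mul_distrib, Finset.prod_const, Finset.card_univ,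
    Fintype.card_sum, Fintype.card_fin]
  have h3 : ∀ w : List ℕ, ∏ i : Fin w.length, partWeight w[i] = listWeight w := fun w => by
    rw [listWeight, ← List.prod_ofFn]
    congr 1
    refine List.ext_getElem (by simp) fun i h1 h2 => by simp
  rw [h3, h3, hk']
  -- The factor 2 in the law of each tree size absorbs the geometric law of the number of trees and
  -- leaves 1/4.
  have h4 : (2⁻¹ : ℝ≥0∞) ^ (u.length + v.length + 1 + 1) * (2 ^ u.length * 2 ^ v.length) = 4⁻¹ := by
    rw [← pow_add, pow_succ, pow_succ, mul_assoc, mul_assoc, mul_comm, mul_assoc, mul_assoc,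
      ← mul_pow, ENNReal.mul_inv_cancel two_ne_zero ENNReal.ofNat_ne_top, one_pow, mul_one,
      four_inv_eq]
  rw [← h4]
  ring

end Spine

/-! ### Point measures of the spine as functions of the size lists -/

/-- The finite measure with unit masses at the successors of the elements of `A`. -/
noncomputable def pointMeasure (A : Finset ℕ) : FiniteMeasure ℕ+ :=
  ∑ a ∈ A, diracFM (Nat.succPNat a)

/-- A part of size one at the 0-based position a ends at a + 1, which is the partial sum up to and
including it. The offset `c` carries the parts already removed, and nonzero sizes keep the hills
distinct. -/
theorem sum_hillSet_ofFn (f : ℕ → ℕ) (k c : ℕ) (hf : ∀ i < k, f i ≠ 0) :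
    ∑ a ∈ hillSet (List.ofFn fun i : Fin k => f i), diracFM (Nat.succPNat (c + a)) =
      ∑ i ∈ Finset.range k,
        if f i = 1 then diracFM (Nat.toPNat' (c + ∑ j ∈ Finset.range (i + 1), f j)) else 0 := by
  induction k generalizing f c with
  | zero => simp [hillSet]
  | succ k ih =>
    have h0 := hf 0 (by omega)
    have hdisj : Disjoint (if f 0 = 1 then ({0} : Finset ℕ) else ∅)
        ((hillSet (List.ofFn fun i : Fin k => f (i + 1))).map (addLeftEmbedding (f 0))) := by
      split_ifs
      · simp [h0]
      · simp
    have hl : hillSet (List.ofFn fun i : Fin (k + 1) => f i) = (if f 0 = 1 then {0} else ∅) ∪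
        (hillSet (List.ofFn fun i : Fin k => f (i + 1))).map (addLeftEmbedding (f 0)) := by
      rw [List.ofFn_succ]
      rfl
    rw [hl, Finset.sum_union hdisj, Finset.sum_map, Finset.sum_range_succ', add_comm]
    congr 1
    · have h := ih (fun i => f (i + 1)) (c + f 0) (fun i hi => hf (i + 1) (by omega))
      simp only [addLeftEmbedding_apply, ← add_assoc]
      rw [h]
      refine Finset.sum_congr rfl fun i _ => ?_
      rw [Finset.sum_range_succ' f (i + 1), ← add_assoc, add_right_comm]
    · by_cases h1 : f 0 = 1
      · simp [h1]
        rfl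
      · simp [h1]

theorem pointMeasure_hillSet_ofFn (f : ℕ → ℕ) (k : ℕ) (hf : ∀ i < k, f i ≠ 0) :
    pointMeasure (hillSet (List.ofFn fun i : Fin k => f i)) =
      ∑ i ∈ Finset.range k,
        if f i = 1 then diracFM (Nat.toPNat' (∑ j ∈ Finset.range (i + 1), f j)) else 0 := by
  simpa [pointMeasure] using sum_hillSet_ofFn f k 0 hf

theorem OrderedTree.coe_natSize {t : OrderedTree} (h : t.natSize ≠ 0) : (t.natSize : ℕ∞) = t.size :=
  ENat.natCast_toNat fun h' => h (t.natSize_eq_zero_iff.2 h')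

theorem OrderedTree.size_eq_one_iff (t : OrderedTree) : t.size = 1 ↔ t.natSize = 1 := by
  have := t.natSize_eq_succ_iff 0
  simpa using this.symm

theorem cumulativeSize_eq {t : ℕ+ → OrderedTree} (ht : ∀ j, (t j).natSize ≠ 0) (a b : ℕ+) :
    cumulativeSize t a b = (∑ j ∈ Finset.Icc a b, (t j).natSize).toPNat' := by
  rw [cumulativeSize, ← Finset.sum_congr rfl fun j _ => OrderedTree.coe_natSize (ht j),
    ← Nat.cast_sum, ENat.toNat_natCast]

theorem spineLeft_eq {t : ℕ+ → OrderedTree} (ht : ∀ j, (t j).natSize ≠ 0) (N : ℕ+) :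
    spineLeft t N = pointMeasure (hillSet (leftList t N)) := by
  classical
  rw [leftList, pointMeasure_hillSet_ofFn (fun i => (t (Nat.succPNat i)).natSize) _
    fun _ _ => ht _, spineLeft]
  refine Finset.sum_nbij' (fun i => (i : ℕ) - 1) (fun i => Nat.succPNat i) ?_ ?_ ?_ ?_ ?_
  · intro i hi
    have h1 : (i : ℕ) < N := (Finset.mem_Ico.1 hi).2
    have := i.pos
    simp; omega
  · intro i hi
    rw [Finset.mem_range] at hi
    refine Finset.mem_Ico.2 ⟨one_le, ?_⟩
    rw [← PNat.coe_lt_coe, Nat.succPNat_coe]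
    omega
  · intro i _
    exact PNat.succPNat_natPred i
  · intro i _
    simp
  · intro i hi
    have hi' : Nat.succPNat ((i : ℕ) - 1) = i := PNat.succPNat_natPred i
    rw [hi']
    refine if_congr (t i).size_eq_one_iff (congrArg diracFM ?_) rfl
    rw [cumulativeSize_eq ht]
    congr 1
    have := i.pos
    refine Finset.sum_nbij' (fun j => (j : ℕ) - 1) (fun j => Nat.succPNat j) ?_ ?_ ?_ ?_ ?_
    · intro j hj
      have h1 : (j : ℕ) ≤ i := (Finset.mem_Icc.1 hj).2
      have := j.pos
      simp; omega
    · intro j hj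
      rw [Finset.mem_range] at hj
      refine Finset.mem_Icc.2 ⟨one_le, ?_⟩
      rw [← PNat.coe_le_coe, Nat.succPNat_coe]
      omega
    · intro j _
      exact PNat.succPNat_natPred j
    · intro j _
      simp
    · intro j _
      rw [show Nat.succPNat ((j : ℕ) - 1) = j from PNat.succPNat_natPred j]

theorem toPNat'_sub_sub {X j : ℕ+} (h : j ≤ X) :
    Nat.toPNat' ((X : ℕ) - ((X : ℕ) - j)) = j := by
  have h' : (j : ℕ) ≤ X := h
  have := j.pos
  apply PNat.eq
  rw [Nat.toPNat'_coe, if_pos (by omega)]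
  omega

theorem coe_toPNat'_sub {X i : ℕ} (h : i < X) : (Nat.toPNat' (X - i) : ℕ) = X - i := by
  rw [Nat.toPNat'_coe, if_pos (by omega)]

/-- The substitution i ↦ X - i reverses the order of the trees, turning the sums from `i` to `X`
into partial sums of `rightList`. -/
theorem spineRight_eq {t : ℕ+ → OrderedTree} (ht : ∀ j, (t j).natSize ≠ 0) (X N : ℕ+) :
    spineRight t X N = pointMeasure (hillSet (rightList t X N)) := by
  classical
  rw [rightList, pointMeasure_hillSet_ofFn (fun i => (t (Nat.toPNat' (X - i))).natSize) _
    fun _ _ => ht _, spineRight]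
  have hNpos := N.pos
  refine Finset.sum_nbij' (fun i => (X : ℕ) - i) (fun i => Nat.toPNat' (X - i)) ?_ ?_ ?_ ?_ ?_
  · intro i hi
    have h1 : (N : ℕ) < i := (Finset.mem_Ioc.1 hi).1
    have h2 : (i : ℕ) ≤ X := (Finset.mem_Ioc.1 hi).2
    simp; omega
  · intro i hi
    rw [Finset.mem_range] at hi
    rw [Finset.mem_Ioc, ← PNat.coe_lt_coe, ← PNat.coe_le_coe, coe_toPNat'_sub (by omega)]
    omega
  · intro i hi
    exact toPNat'_sub_sub (Finset.mem_Ioc.1 hi).2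
  · intro i hi
    rw [Finset.mem_range] at hi
    rw [coe_toPNat'_sub (by omega)]
    omega
  · intro i hi
    have hiX := (Finset.mem_Ioc.1 hi).2
    have hiX' : (i : ℕ) ≤ X := hiX
    have hipos := i.pos
    rw [toPNat'_sub_sub hiX]
    refine if_congr (t i).size_eq_one_iff (congrArg diracFM ?_) rfl
    rw [cumulativeSize_eq ht]
    congr 1
    refine Finset.sum_nbij' (fun j => (X : ℕ) - j) (fun j => Nat.toPNat' (X - j)) ?_ ?_ ?_ ?_ ?_
    · intro j hj
      have h1 : (i : ℕ) ≤ j := (Finset.mem_Icc.1 hj).1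
      have h2 : (j : ℕ) ≤ X := (Finset.mem_Icc.1 hj).2
      simp; omega
    · intro j hj
      rw [Finset.mem_range] at hj
      rw [Finset.mem_Icc, ← PNat.coe_le_coe, ← PNat.coe_le_coe, coe_toPNat'_sub (by omega)]
      omega
    · intro j hj
      exact toPNat'_sub_sub (Finset.mem_Icc.1 hj).2
    · intro j hj
      rw [Finset.mem_range] at hj
      rw [coe_toPNat'_sub (by omega)]
      omega
    · intro j hj
      rw [toPNat'_sub_sub (Finset.mem_Icc.1 hj).2]

/-! ### Convergence in distribution on a countable discrete space -/

/-- Pairs of finite sets of positions, as a discrete space. -/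
@[ext]
structure PositionPair where
  left : Finset ℕ
  right : Finset ℕ

instance : TopologicalSpace PositionPair := ⊥

instance : DiscreteTopology PositionPair := ⟨rfl⟩

instance : MeasurableSpace PositionPair := ⊤

instance : BorelSpace PositionPair := ⟨(borel_eq_top_of_discrete (α := PositionPair)).symm⟩

instance : Countable PositionPair :=
  Function.Injective.countable (f := fun p : PositionPair => (p.left, p.right)) fun _ _ h =>
    PositionPair.ext (congrArg Prod.fst h) (congrArg Prod.snd h)

/-- The pair of point measures with given positions. -/
noncomputable def pointMeasurePair (p : PositionPair) : FiniteMeasurePair :=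
  (pointMeasure p.left, pointMeasure p.right)

/-- On a countable discrete space, convergence of point probabilities implies convergence in
distribution. -/
theorem tendstoInDistribution_of_tendsto_singleton {S : Type*} [TopologicalSpace S]
    [DiscreteTopology S] [MeasurableSpace S] [BorelSpace S] [Countable S]
    {Ω : Type*} [MeasurableSpace Ω] {μ : Measure Ω} [IsProbabilityMeasure μ]
    {Ω' : ℕ → Type*} [∀ n, MeasurableSpace (Ω' n)]
    {P : (n : ℕ) → Measure (Ω' n)} [∀ n, IsProbabilityMeasure (P n)]
    {Y : (n : ℕ) → Ω' n → S} {Z : Ω → S} (hY : ∀ n, AEMeasurable (Y n) (P n))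
    (hZ : AEMeasurable Z μ)
    (h : ∀ s, Tendsto (fun n => P n (Y n ⁻¹' {s})) atTop (nhds (μ (Z ⁻¹' {s})))) :
    TendstoInDistribution Y atTop Z P μ := by
  refine ⟨hY, hZ, ?_⟩
  refine tendsto_of_forall_isOpen_le_liminf' fun G _ => ?_
  have hmeas : ∀ A : Set S, MeasurableSet A := fun A => A.to_countable.measurableSet
  -- Measures of open sets become integrals against counting measure, so Fatou's lemma yields the
  -- portmanteau lower bound; no separate tightness is needed, as the limit is a probability
  -- measure.
  have hsum : ∀ ν : Measure S, ν G = ∫⁻ s, G.indicator (fun x => ν {x}) s ∂Measure.count :=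
    fun ν => by rw [lintegral_count, Measure.tsum_indicator_apply_singleton _ _ (hmeas G)]
  have hlim : ∀ s, Tendsto (fun n => G.indicator (fun x => (P n).map (Y n) {x}) s) atTop
      (nhds (G.indicator (fun x => μ.map Z {x}) s)) := by
    intro s
    by_cases hs : s ∈ G
    · simp only [Set.indicator_of_mem hs, Measure.map_apply_of_aemeasurable (hY _) (hmeas _),
        Measure.map_apply_of_aemeasurable hZ (hmeas _)]
      exact h s
    · simp only [Set.indicator_of_notMem hs]
      exact tendsto_const_nhds
  calc μ.map Z G = ∫⁻ s, liminf (fun n => G.indicator (fun x => (P n).map (Y n) {x}) s) atTop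
        ∂Measure.count := by
        rw [hsum]
        exact lintegral_congr fun s => (hlim s).liminf_eq.symm
    _ ≤ liminf (fun n => ∫⁻ s, G.indicator (fun x => (P n).map (Y n) {x}) s ∂Measure.count) atTop :=
        lintegral_liminf_le fun n => measurable_of_countable _
    _ = liminf (fun n => (P n).map (Y n) G) atTop := by simp only [← hsum]

/-! ### Fixed-point positions and the limits of their probabilities -/

/-- The fixed points in the first half. -/
def leftPositions {n : ℕ} (τ : Equiv.Perm (Fin n)) : Finset ℕ :=
  (fixedSet τ).filter fun a => a + 1 ≤ n / 2

/-- The fixed points in the second half, counted from the right end. -/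
def rightPositions {n : ℕ} (τ : Equiv.Perm (Fin n)) : Finset ℕ :=
  revSet n ((fixedSet τ).filter fun a => n / 2 + 1 ≤ a + 1)

theorem fixedPointsLeft_eq {n : ℕ} (τ : Equiv.Perm (Fin n)) :
    fixedPointsLeft τ = pointMeasure (leftPositions τ) := by
  rw [fixedPointsLeft, pointMeasure, leftPositions, Finset.sum_filter, fixedSet, Finset.sum_map,
    Finset.sum_filter]
  refine Finset.sum_congr rfl fun a _ => ?_
  by_cases h1 : τ a = a <;> simp [h1]

theorem fixedPointsRight_eq {n : ℕ} (τ : Equiv.Perm (Fin n)) :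
    fixedPointsRight τ = pointMeasure (rightPositions τ) := by
  rw [fixedPointsRight, pointMeasure, rightPositions, revSet, Finset.sum_image, Finset.sum_filter,
    fixedSet, Finset.sum_map, Finset.sum_filter]
  · refine Finset.sum_congr rfl fun a _ => ?_
    have h2 : Nat.succPNat (a.rev : ℕ) = Nat.succPNat (n - 1 - (a : ℕ)) := by
      congr 1
      rw [Fin.val_rev]
      omega
    rw [h2]
    by_cases h1 : τ a = a <;> simp [h1]
  · intro x hx y hy h
    have h1 := lt_of_mem_fixedSet (Finset.mem_filter.1 hx).1
    have h2 := lt_of_mem_fixedSet (Finset.mem_filter.1 hy).1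
    simp only at h
    omega

theorem positions_eq_iff {n : ℕ} (τ : Equiv.Perm (Fin n)) {A B : Finset ℕ}
    (hA : A ⊆ Finset.range (n / 2)) (hB : B ⊆ Finset.range (n - n / 2)) :
    leftPositions τ = A ∧ rightPositions τ = B ↔ fixedSet τ = A ∪ revSet n B := by
  have hBn : B ⊆ Finset.range n := hB.trans (Finset.range_mono (by omega))
  have hrev : ∀ x ∈ revSet n B, n / 2 ≤ x := by
    intro x hx
    obtain ⟨b, hb, rfl⟩ := Finset.mem_image.1 hx
    have := Finset.mem_range.1 (hB hb)
    omega
  constructor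
  · rintro ⟨rfl, rfl⟩
    rw [rightPositions, revSet_revSet ((Finset.filter_subset _ _).trans (fixedSet_subset τ)),
      leftPositions, ← Finset.filter_or, Finset.filter_true_of_mem]
    intro x _
    omega
  · intro h
    constructor
    · rw [leftPositions, h]
      ext x
      simp only [Finset.mem_filter, Finset.mem_union]
      constructor
      · rintro ⟨h1 | h1, h2⟩
        · exact h1
        · have := hrev x h1; omega
      · intro hx
        have := Finset.mem_range.1 (hA hx)
        exact ⟨Or.inl hx, by omega⟩
    · rw [rightPositions, h]
      suffices ((A ∪ revSet n B).filter fun a => n / 2 + 1 ≤ a + 1) = revSet n B by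
        rw [this, revSet_revSet hBn]
      ext x
      simp only [Finset.mem_filter, Finset.mem_union]
      constructor
      · rintro ⟨h1 | h1, h2⟩
        · have := Finset.mem_range.1 (hA h1); omega
        · exact h1
      · exact fun hx => ⟨Or.inr hx, by have := hrev x hx; omega⟩

instance instDiscreteMeasurableSpacePermFin (n : ℕ) :
    DiscreteMeasurableSpace (Equiv.Perm (Fin n)) := ⟨fun _ => trivial⟩

theorem uniformOn_Av321_fixedSet (n : ℕ) (F : Finset ℕ) :
    uniformOn (Av321 n) {τ | fixedSet τ = F} = fixCount n F / catalan n := by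
  classical
  have h1 : Av321 n = ((Av321 n).toFinset : Set (Equiv.Perm (Fin n))) := by simp
  have h2 : {τ : Equiv.Perm (Fin n) | fixedSet τ = F} =
      ↑(Finset.univ.filter fun τ : Equiv.Perm (Fin n) => fixedSet τ = F) := by
    ext; simp
  rw [← ncard_Av321, fixCount, Set.ncard_eq_toFinset_card', Set.ncard_eq_toFinset_card' (Av321 n)]
  conv_lhs => rw [h1, h2]
  rw [uniformOn_apply_finset]
  congr 3
  ext τ
  simp

/-- After shifting `n` by the prescribed lengths, only the middle Fine number varies, and its ratio
to the Catalan number converges. The constants agree through 4/9 = (1/4)(4/3)². -/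
theorem tendsto_fixCount_div_catalan (G H : List ℕ) :
    Tendsto (fun n => (fixCount n (posSet G ∪ revSet n (posSet H)) : ℝ≥0∞) / catalan n) atTop
      (nhds (4⁻¹ * (4 / 3 * (4⁻¹ ^ gapLength G * (G.map fineNumber).prod) *
        (4 / 3 * (4⁻¹ ^ gapLength H * (H.map fineNumber).prod))))) := by
  rw [← tendsto_add_atTop_iff_nat (gapLength G + gapLength H)]
  set p : ℕ := (G.map fineNumber).prod
  set q : ℕ := (H.map fineNumber).prod
  have hreal := (tendsto_fineNumber_div_add (gapLength G + gapLength H)).const_mul ((p : ℝ) * q)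
  have h := ENNReal.tendsto_ofReal hreal
  have hval : ENNReal.ofReal ((p : ℝ) * q * (4 / 9 * (1 / 4) ^ (gapLength G + gapLength H))) =
      4⁻¹ * (4 / 3 * (4⁻¹ ^ gapLength G * p) * (4 / 3 * (4⁻¹ ^ gapLength H * q))) := by
    have hne : (4⁻¹ * (4 / 3 * (4⁻¹ ^ gapLength G * p) *
        (4 / 3 * (4⁻¹ ^ gapLength H * q))) : ℝ≥0∞) ≠ ⊤ := by finiteness
    rw [← ENNReal.ofReal_toReal hne]
    congr 1
    simp only [ENNReal.toReal_mul, ENNReal.toReal_inv, ENNReal.toReal_div, ENNReal.toReal_pow,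
      ENNReal.toReal_ofNat, ENNReal.toReal_natCast]
    rw [pow_add]
    ring
  rw [hval] at h
  refine h.congr fun m => ?_
  rw [show m + (gapLength G + gapLength H) = gapLength G + (gapLength H + m) by ring,
    fixCount_posSet_revSet, show gapLength G + gapLength H + m = gapLength G + (gapLength H + m) by
    ring, ← mul_div_assoc, ENNReal.ofReal_div_of_pos (by exact_mod_cast catalan_pos _)]
  rw [ENNReal.ofReal_natCast, ← ENNReal.ofReal_natCast (p * q * fineNumber m)]
  push_cast
  rfl

theorem tsum_listWeight_mul_listWeight (A B : Finset ℕ) :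
    ∑' w : {w : List ℕ × List ℕ | hillSet w.1 = A ∧ hillSet w.2 = B},
      4⁻¹ * (listWeight w.1.1 * listWeight w.1.2) = 4⁻¹ * (hillWeight A * hillWeight B) := by
  classical
  rw [ENNReal.tsum_mul_left]
  congr 1
  rw [tsum_subtype {w : List ℕ × List ℕ | hillSet w.1 = A ∧ hillSet w.2 = B}
    fun w => listWeight w.1 * listWeight w.2, ENNReal.tsum_prod',
    hillWeight, ← ENNReal.tsum_mul_right]
  refine tsum_congr fun u => ?_
  rw [hillWeight, ← ENNReal.tsum_mul_left]
  refine tsum_congr fun v => ?_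
  by_cases hu : hillSet u = A <;> by_cases hv : hillSet v = B <;> simp [Set.indicator, hu, hv]

section Spine

variable {Ω : Type*} [MeasurableSpace Ω] {μ : Measure Ω} [IsProbabilityMeasure μ]
    {T : ℕ+ → Ω → OrderedTree} {X N : Ω → ℕ+}

theorem measurableSet_leftList_rightList (hT : ∀ j, Measurable (T j))
    (hX_meas : Measurable X) (hN_meas : Measurable N) (u v : List ℕ) :
    MeasurableSet {ω | leftList (fun j => T j ω) (N ω) = u ∧
      rightList (fun j => T j ω) (X ω) (N ω) = v} := by
  -- The trees on the right are read at labels depending on the random `X`; joint measurability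
  -- holds because the label set is countable.
  have hjoint : Measurable fun p : ℕ+ × Ω => (T p.1 p.2).natSize :=
    measurable_from_prod_countable_right fun j => OrderedTree.measurable_natSize.comp (hT j)
  have hmeas : ∀ (h : ℕ+ → ℕ+) (c : ℕ), MeasurableSet {ω | (T (h (X ω)) ω).natSize = c} :=
    fun h c => (hjoint.comp (((measurable_of_countable h).comp hX_meas).prodMk measurable_id))
      (measurableSet_singleton c)
  have hXN : ∀ s : Set (ℕ+ × ℕ+), MeasurableSet {ω | (X ω, N ω) ∈ s} := fun s =>
    (hX_meas.prodMk hN_meas) s.to_countable.measurableSet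
  simp only [leftList_eq_iff, rightList_eq_iff]
  have hu : MeasurableSet {ω | ∀ i : Fin u.length, (T (Nat.succPNat i) ω).natSize = u[i]} := by
    rw [Set.ofPred_forall]
    exact MeasurableSet.iInter fun i => hmeas (fun _ => Nat.succPNat i) _
  have hv : MeasurableSet
      {ω | ∀ i : Fin v.length, (T (Nat.toPNat' (X ω - i)) ω).natSize = v[i]} := by
    rw [Set.ofPred_forall]
    exact MeasurableSet.iInter fun i => hmeas (fun x => Nat.toPNat' (x - i)) _
  exact ((hXN {p | (p.2 : ℕ) - 1 = u.length}).inter hu).inter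
    ((hXN {p | (p.1 : ℕ) - p.2 = v.length}).inter hv)

/-- The positions of the single-vertex trees on both sides of the spine. -/
noncomputable def spinePositions (t : ℕ+ → OrderedTree) (X N : ℕ+) : PositionPair :=
  ⟨hillSet (leftList t N), hillSet (rightList t X N)⟩

theorem measurable_spinePositions (hT : ∀ j, Measurable (T j))
    (hX_meas : Measurable X) (hN_meas : Measurable N) :
    Measurable fun ω => spinePositions (fun j => T j ω) (X ω) (N ω) := by
  refine measurable_to_countable' fun p => ?_
  have : (fun ω => spinePositions (fun j => T j ω) (X ω) (N ω)) ⁻¹' {p} =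
      ⋃ w ∈ {w : List ℕ × List ℕ | ⟨hillSet w.1, hillSet w.2⟩ = p},
        {ω | leftList (fun j => T j ω) (N ω) = w.1 ∧
          rightList (fun j => T j ω) (X ω) (N ω) = w.2} := by
    ext ω
    simp [spinePositions]
  rw [this]
  exact MeasurableSet.biUnion (Set.to_countable _) fun w _ =>
    measurableSet_leftList_rightList hT hX_meas hN_meas w.1 w.2

theorem measure_spinePositions
    (hT : ∀ j, IsGaltonWatsonTree geomHalf (T j) μ)
    (hT_indep : iIndepFun T μ)
    (hX_meas : Measurable X) (hN_meas : Measurable N)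
    (hX : ∀ k : ℕ+, μ (X ⁻¹' {k}) = sizeBiased geomHalf k)
    (hN : ∀ k m : ℕ+, m ≤ k → (cond μ (X ⁻¹' {k})) (N ⁻¹' {m}) = (k : ℝ≥0∞)⁻¹)
    (hXN_indep : IndepFun (fun ω => (X ω, N ω)) (fun ω j => T j ω) μ) (A B : Finset ℕ) :
    μ ((fun ω => spinePositions (fun j => T j ω) (X ω) (N ω)) ⁻¹' {⟨A, B⟩}) =
      4⁻¹ * (hillWeight A * hillWeight B) := by
  classical
  let L : Ω → List ℕ × List ℕ := fun ω =>
    (leftList (fun j => T j ω) (N ω), rightList (fun j => T j ω) (X ω) (N ω))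
  have hL : ∀ w : List ℕ × List ℕ, L ⁻¹' {w} = {ω | leftList (fun j => T j ω) (N ω) = w.1 ∧
      rightList (fun j => T j ω) (X ω) (N ω) = w.2} := fun w => by
    ext ω
    simp [L, Prod.ext_iff]
  let S : Set (List ℕ × List ℕ) := {w | hillSet w.1 = A ∧ hillSet w.2 = B}
  have h1 : (fun ω => spinePositions (fun j => T j ω) (X ω) (N ω)) ⁻¹' {⟨A, B⟩} = L ⁻¹' S := by
    ext ω
    simp [spinePositions, S, L]
  rw [h1, ← tsum_measure_preimage_singleton S.to_countable fun w _ => by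
    rw [hL]
    exact measurableSet_leftList_rightList (fun j => (hT j).1) hX_meas hN_meas w.1 w.2]
  simp only [hL, measure_leftList_rightList hT hT_indep hX_meas hN_meas hX hN hXN_indep]
  exact tsum_listWeight_mul_listWeight A B

end Spine

/-- The positions of the fixed points, counted from both ends. -/
def fixedPositions {n : ℕ} (τ : Equiv.Perm (Fin n)) : PositionPair :=
  ⟨leftPositions τ, rightPositions τ⟩

theorem mainTheorem2
    {Ω : Type*} [MeasurableSpace Ω] (μ : Measure Ω) [IsProbabilityMeasure μ]
    (T : ℕ+ → Ω → OrderedTree) (X N : Ω → ℕ+)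
    (hT : ∀ j, IsGaltonWatsonTree geomHalf (T j) μ)
    (hT_indep : iIndepFun T μ)
    (hX_meas : Measurable X) (hN_meas : Measurable N)
    (hX : ∀ k : ℕ+, μ (X ⁻¹' {k}) = sizeBiased geomHalf k)
    (hN : ∀ k m : ℕ+, m ≤ k → (cond μ (X ⁻¹' {k})) (N ⁻¹' {m}) = (k : ℝ≥0∞)⁻¹)
    (hXN_indep : IndepFun (fun ω => (X ω, N ω)) (fun ω j => T j ω) μ)
    {Ω' : ℕ → Type*} [∀ n, MeasurableSpace (Ω' n)]
    (P : (n : ℕ) → Measure (Ω' n)) [∀ n, IsProbabilityMeasure (P n)]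
    (τ : (n : ℕ) → Ω' n → Equiv.Perm (Fin n))
    (hτ : ∀ n, HasLaw (τ n) (uniformOn (Av321 n)) (P n)) :
    TendstoInDistribution (fun n ω => fixedPointPair (τ n ω)) atTop
      (fun ω => spinePair (fun j => T j ω) (X ω) (N ω)) P μ := by
  have hlaw := measure_spinePositions hT hT_indep hX_meas hN_meas hX hN hXN_indep
  -- A quarter of the square of this weight is the probability of seeing no hill on either side,
  -- hence finite.
  have hfin : hillWeight ∅ ≠ ⊤ := by
    intro h
    have h1 := hlaw ∅ ∅
    rw [h, ENNReal.top_mul_top, ENNReal.mul_top (by simp)] at h1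
    exact measure_ne_top _ _ h1
  have hmain : TendstoInDistribution
      (fun n ω => fixedPositions (τ n ω)) atTop
      (fun ω => spinePositions (fun j => T j ω) (X ω) (N ω)) P μ := by
    refine tendstoInDistribution_of_tendsto_singleton
      (fun n => (Measurable.of_discrete (f := fixedPositions)).comp_aemeasurable
        (hτ n).aemeasurable)
      (measurable_spinePositions (fun j => (hT j).1) hX_meas hN_meas).aemeasurable ?_
    rintro ⟨A, B⟩
    obtain ⟨G, rfl⟩ := posSet_surjective A
    obtain ⟨H, rfl⟩ := posSet_surjective B
    rw [hlaw, hillWeight_posSet hfin, hillWeight_posSet hfin]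
    refine (tendsto_fixCount_div_catalan G H).congr' ?_
    -- For such `n` the two prescribed sets lie in separate halves, so the pair of positions
    -- determines the whole fixed-point set.
    filter_upwards [eventually_ge_atTop (2 * (gapLength G + gapLength H))] with n hn
    rw [← uniformOn_Av321_fixedSet, ← (hτ n).measure_eq (MeasurableSet.of_discrete)]
    congr 1
    ext ω
    rw [Set.mem_ofPred_eq, ← positions_eq_iff (τ n ω)
      ((posSet_subset G).trans (Finset.range_mono (by omega)))
      ((posSet_subset H).trans (Finset.range_mono (by omega)))]
    simp [fixedPositions]
  refine (hmain.continuous_comp (g := pointMeasurePair) continuous_of_discreteTopology).congr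
    (fun n => ae_of_all _ fun ω => ?_) ?_
  · exact (Prod.ext (fixedPointsLeft_eq (τ n ω)) (fixedPointsRight_eq (τ n ω))).symm
  · filter_upwards [ae_all_iff.2 fun j => (hT j).ae_natSize_ne_zero] with ω hω
    exact (Prod.ext (spineLeft_eq hω (N ω)) (spineRight_eq hω (X ω) (N ω))).symm
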